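/- **Setting.** For each $n\ge 0$ let $p_{00}(n),p_{01}(n),p_{10}(n),p_{11}(n)\ge 0$ have sum $1$, and write $p_{0+}=p_{00}+p_{01}$, $p_{1+}=p_{10}+p_{11}$, $p_{+0}=p_{00}+p_{10}$, $p_{+1}=p_{01}+p_{11}$. Let $(\xi_i(n),\eta_i(n))$, $i\ge 1$, $n\ge 0$, be independent random vectors with values in $\{0,1,2,\dots\}^2$ such that $(\xi_i(n),\eta_i(n))$ has the bivariate geometric distribution with parameters $p_{ij}=p_{ij}(n)$: $$P(\xi=l,\eta=k)=\begin{cases}p_{00}^{l}\,p_{10}\,p_{+0}^{k-l-1}\,p_{+1}, & 0\le l<k,\\ p_{00}^{l}\,p_{11}, & l=k,\\ p_{00}^{k}\,p_{01}\,p_{0+}^{l-k-1}\,p_{1+}, & 0\le k<l.\end{cases}$$ Let $\{Z_n\}$ be the bisexual branching process with promiscuous mating function $L(x,y)=x\min\{1,y\}$: $Z_0=N$ for an integer $N>0$, and $$Z_{n+1}=L\Big(\sum_{i=1}^{Z_n}\xi_i(n),\ \sum_{i=1}^{Z_n}\eta_i(n)\Big),\qquad n\ge 0 .$$ Let $r_{n1}=E(Z_{n+1}\mid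 Z_n=1)=E\,L(\xi_1(n),\eta_1(n))$, $\mu_0=1$, $\mu_n=\prod_{i=0}^{n-1}r_{i1}$, and define the offspring maxima $$(\mathcal M_n^F,\mathcal M_n^M)=\Big(\max_{1\le i\le Z_n}\xi_i(n),\ \max_{1\le i\le Z_n}\eta_i(n)\Big)$$ (a maximum over the empty set is $0$). **Theorem.** Assume that $\mu_n\to\infty$, that $p_{11}(n)>0$ for all large $n$, and that there are constants $0\le a,b,c<\infty$ such that $$\lim_{n\to\infty}p_{11}(n)\log\mu_n=2c,\qquad \lim_{n\to\infty}\frac{p_{10}(n)}{p_{11}(n)}\log\mu_n=a,\qquad \lim_{n\to\infty}\frac{p_{01}(n)}{p_{11}(n)}\log\mu_n=b .$$ Assume also that $$\prod_{j=1}^\infty p_{+0}(j)\,p_{0+}(j)\ne 0\qquad\text{and}\qquad \sum_{n=0}^\infty p_{+1}(n)<\infty .$$ Then $Z_n/\mu_n$ converges almost surely to a nonnegative random variable $W$ with $E(W)<\infty$ and $P(W>0)>0$, and for all real $x,y$ $$\lim_{n\to\infty}P\big(p_{11}(n)\mathcal M_n^F-\log\mu_n\le x,\ p_{11}(n)\mathcal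 M_n^M-\log\mu_n\le y\big)=\int_{[0,\infty)}G(x,y)^z\,dP(W\le z),$$ where $$G(x,y)=\exp\left\{-e^{-x-a-c}-e^{-y-b-c}+e^{-\max\{x,y\}-a-b-c}\right\}.$$ -/

import Mathlib

open Filter Topology MeasureTheory ProbabilityTheory

noncomputable section

namespace BisexualBranching

/-- The law of a pair `(U, V)` of 0-1 valued random variables: `pij = P(U = i, V = j)`. -/
structure BernoulliPair where
  p00 : ℝ
  p01 : ℝ
  p10 : ℝ
  p11 : ℝ
  p00_nonneg : 0 ≤ p00
  p01_nonneg : 0 ≤ p01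
  p10_nonneg : 0 ≤ p10
  p11_nonneg : 0 ≤ p11
  sum_eq_one : p00 + p01 + p10 + p11 = 1

namespace BernoulliPair

/-- `P(U = 0)`. -/
def p0Plus (p : BernoulliPair) : ℝ := p.p00 + p.p01

/-- `P(U = 1)`. -/
def p1Plus (p : BernoulliPair) : ℝ := p.p10 + p.p11

/-- `P(V = 0)`. -/
def pPlus0 (p : BernoulliPair) : ℝ := p.p00 + p.p10

/-- `P(V = 1)`. -/
def pPlus1 (p : BernoulliPair) : ℝ := p.p01 + p.p11

end BernoulliPair

/-- Probability mass function of the bivariate geometric distribution of Marshall and Olkin: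
the joint law of the numbers of zeros that precede the first 1 in `U₁, U₂, …` and in
`V₁, V₂, …`, where the pairs `(Uₙ, Vₙ)` are independent with common law `p`. -/
def bivGeomPMF (p : BernoulliPair) (l k : ℕ) : ℝ :=
  if l < k then p.p00 ^ l * p.p10 * p.pPlus0 ^ (k - l - 1) * p.pPlus1
  else if l = k then p.p00 ^ l * p.p11
  else p.p00 ^ k * p.p01 * p.p0Plus ^ (l - k - 1) * p.p1Plus

/-- The promiscuous mating function `L(x, y) = x min{1, y}`. -/
def promiscuous (x y : ℕ) : ℕ := x * min 1 y

variable {Ω : Type*}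

/-- The bisexual branching process with mating function `L`, started from `N` mating units.
The `i`-th mating unit of generation `n` (with `i = 0, 1, …`) has `ξ n i` female and `η n i`
male offspring. -/
def process (L : ℕ → ℕ → ℕ) (N : ℕ) (ξ η : ℕ → ℕ → Ω → ℕ) : ℕ → Ω → ℕ
  | 0, _ => N
  | n + 1, ω =>
      L (∑ i ∈ Finset.range (process L N ξ η n ω), ξ n i ω)
        (∑ i ∈ Finset.range (process L N ξ η n ω), η n i ω)

/-- Largest number of offspring of the kind counted by `ξ` among the mating units of
generation `n`, when generation `n` has `Z n` mating units (it is `0` if there are none). -/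
def offspringMax (Z : ℕ → Ω → ℕ) (ξ : ℕ → ℕ → Ω → ℕ) (n : ℕ) (ω : Ω) : ℕ :=
  (Finset.range (Z n ω)).sup fun i => ξ n i ω

variable [MeasurableSpace Ω]

/-- Mean growth rate per mating unit, `r_{nj} = j⁻¹ E(Z_{n+1} | Z_n = j)`. As the offspring
vectors of generation `n` are independent of `Z_n`, the conditional law of `Z_{n+1}` given
`Z_n = j` is the law of `L` at the total offspring of `j` mating units. -/
def growthRate (P : Measure Ω) (L : ℕ → ℕ → ℕ) (ξ η : ℕ → ℕ → Ω → ℕ) (n j : ℕ) : ℝ :=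
  (j : ℝ)⁻¹ *
    ∫ ω, (L (∑ i ∈ Finset.range j, ξ n i ω) (∑ i ∈ Finset.range j, η n i ω) : ℝ) ∂P

/-- `μ_n = r_{01} r_{11} ⋯ r_{n-1,1}`, with `μ_0 = 1`. -/
def meanGrowth (P : Measure Ω) (L : ℕ → ℕ → ℕ) (ξ η : ℕ → ℕ → Ω → ℕ) (n : ℕ) : ℝ :=
  ∏ i ∈ Finset.range n, growthRate P L ξ η i 1

/-- The offspring vectors `(ξ n i, η n i)` are random vectors, independent over all `n, i ≥ 0`,
and `(ξ n i, η n i)` has the bivariate geometric law with parameters `p n`. -/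
structure IsBivGeomArray (P : Measure Ω) (p : ℕ → BernoulliPair) (ξ η : ℕ → ℕ → Ω → ℕ) :
    Prop where
  measurable_fst : ∀ n i, Measurable (ξ n i)
  measurable_snd : ∀ n i, Measurable (η n i)
  indep : iIndepFun (fun (t : ℕ × ℕ) (ω : Ω) => (ξ t.1 t.2 ω, η t.1 t.2 ω)) P
  law : ∀ n i l k, P.real {ω | ξ n i ω = l ∧ η n i ω = k} = bivGeomPMF (p n) l k

/-- `G(x, y) = exp(-e^{-x-a-c} - e^{-y-b-c} + e^{-max(x,y)-a-b-c})`. -/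
def limitG (a b c x y : ℝ) : ℝ :=
  Real.exp (-Real.exp (-x - a - c) - Real.exp (-y - b - c)
    + Real.exp (-max x y - a - b - c))

end BisexualBranching

end

/-! Growth. A mating unit with a son makes the male total positive, so `Z (n+1)` lies between the
number of females having a brother and the number of all females. Given `Z n`, these have means `Z n
* p00 / p1Plus` and `Z n * (p00 + p01) / p1Plus`; the first factor is `r_{n1}`, and the two differ
by the relative amount `p01 / p00`, which is summable because `p01 ≤ pPlus1` and `p00 → 1`. Hence `N
μ_n ≤ E Z_n ≤ K μ_n`. A variance bound then makes the L¹ norms of the increments of `Z_n / μ_n` at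
most of order `μ_n^(-1/2) + p01`, up to the factor `1 / p00`. This is summable, since `μ_n / μ_{n+1}
= p1Plus / p00 → 0`. So `Z_n / μ_n` converges almost surely and in mean, and `E W ≥ N > 0`
(`lintegral_abs_div_meanGrowth_sub_le`, `exists_limit_of_summable_increments`, `exists_limit`).

Maxima. `Z_n` is independent of the offspring vectors of generation `n`, so the joint distribution
function of the maxima is `E (1 - e_n)^{Z_n}`, where `e_n` is the probability that one unit exceeds
a level (`measureReal_forall_le`). If `μ_n e_n → λ` with `G = exp (-λ)`, then `(1 - e_n)^{Z_n} → exp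
(-λ W)` almost surely, and dominated convergence concludes.

The limit `λ` comes from inclusion-exclusion (`tendsto_exp_mul_exceedance`). At a level `m` with
`p11 m = log μ_n + x + o(1)` the tail of `ξ` is `(1 - q)^m`, `q = p11 + p10`. In `m log (1 - q)` the
term `-m q` gives `-log μ_n - x - a` and the term `-m q² / 2` gives `-c`; the rest vanishes. The
joint tail is the marginal tail at the larger level times a correction tending to `exp (-a)` or `exp
(-b)`. -/

namespace BisexualBranching

/-! ### The bivariate geometric law: survival function and moments. -/

namespace BernoulliPair

/-- The bivariate geometric survival function `P(ξ ≥ l, η ≥ k)`. -/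
noncomputable def survival (p : BernoulliPair) (l k : ℕ) : ℝ :=
  if l ≤ k then p.p00 ^ l * p.pPlus0 ^ (k - l) else p.p00 ^ k * p.p0Plus ^ (l - k)

lemma survival_of_le (p : BernoulliPair) {l k : ℕ} (h : l ≤ k) :
    p.survival l k = p.p00 ^ l * p.pPlus0 ^ (k - l) := if_pos h

lemma survival_of_ge (p : BernoulliPair) {l k : ℕ} (h : k ≤ l) :
    p.survival l k = p.p00 ^ k * p.p0Plus ^ (l - k) := by
  unfold survival
  split_ifs with h'
  · obtain rfl : l = k := le_antisymm h' h
    simp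
  · rfl

lemma pPlus0_nonneg (p : BernoulliPair) : 0 ≤ p.pPlus0 :=
  add_nonneg p.p00_nonneg p.p10_nonneg

lemma p0Plus_nonneg (p : BernoulliPair) : 0 ≤ p.p0Plus :=
  add_nonneg p.p00_nonneg p.p01_nonneg

lemma pPlus1_nonneg (p : BernoulliPair) : 0 ≤ p.pPlus1 :=
  add_nonneg p.p01_nonneg p.p11_nonneg

lemma p1Plus_nonneg (p : BernoulliPair) : 0 ≤ p.p1Plus :=
  add_nonneg p.p10_nonneg p.p11_nonneg

lemma p0Plus_add_p1Plus (p : BernoulliPair) : p.p0Plus + p.p1Plus = 1 := by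
  have := p.sum_eq_one
  unfold p0Plus p1Plus
  linarith

lemma pPlus0_add_pPlus1 (p : BernoulliPair) : p.pPlus0 + p.pPlus1 = 1 := by
  have := p.sum_eq_one
  unfold pPlus0 pPlus1
  linarith

/-- The mixed second difference of the survival function is the probability mass function. -/
lemma survival_mixed_difference (p : BernoulliPair) (l k : ℕ) :
    (p.survival l k - p.survival (l + 1) k) - (p.survival l (k + 1) - p.survival (l + 1) (k + 1))
      = bivGeomPMF p l k := by
  have hs := p.sum_eq_one
  rcases lt_trichotomy l k with h | rfl | h
  · obtain ⟨d, rfl⟩ : ∃ d, k = l + 1 + d := ⟨k - (l + 1), by omega⟩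
    rw [p.survival_of_le (by omega : l ≤ l + 1 + d),
      p.survival_of_le (by omega : l + 1 ≤ l + 1 + d),
      p.survival_of_le (by omega : l ≤ l + 1 + d + 1),
      p.survival_of_le (by omega : l + 1 ≤ l + 1 + d + 1), bivGeomPMF, if_pos h,
      show l + 1 + d - l = d + 1 by omega, show l + 1 + d - (l + 1) = d by omega,
      show l + 1 + d + 1 - l = d + 2 by omega, show l + 1 + d + 1 - (l + 1) = d + 1 by omega,
      show d + 1 - 1 = d by omega]
    have h1 : p.p10 = p.pPlus0 - p.p00 := by unfold pPlus0; ring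
    have h2 : p.pPlus1 = 1 - p.pPlus0 := by linarith [p.pPlus0_add_pPlus1]
    rw [h1, h2]
    ring
  · rw [p.survival_of_le le_rfl, p.survival_of_ge (by omega : l ≤ l + 1),
      p.survival_of_le (by omega : l ≤ l + 1), p.survival_of_le le_rfl, bivGeomPMF,
      if_neg (lt_irrefl l), if_pos rfl]
    have h1 : p.p11 = 1 - p.p00 - p.p01 - p.p10 := by linarith
    simp only [Nat.sub_self, Nat.add_sub_cancel_left, h1, pPlus0, p0Plus]
    ring
  · obtain ⟨d, rfl⟩ : ∃ d, l = k + 1 + d := ⟨l - (k + 1), by omega⟩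
    rw [p.survival_of_ge (by omega : k ≤ k + 1 + d),
      p.survival_of_ge (by omega : k + 1 ≤ k + 1 + d),
      p.survival_of_ge (by omega : k ≤ k + 1 + d + 1),
      p.survival_of_ge (by omega : k + 1 ≤ k + 1 + d + 1), bivGeomPMF, if_neg (by omega),
      if_neg (by omega),
      show k + 1 + d - k = d + 1 by omega, show k + 1 + d - (k + 1) = d by omega,
      show k + 1 + d + 1 - k = d + 2 by omega, show k + 1 + d + 1 - (k + 1) = d + 1 by omega,
      show d + 1 - 1 = d by omega]
    have h1 : p.p01 = p.p0Plus - p.p00 := by unfold p0Plus; ring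
    have h2 : p.p1Plus = 1 - p.p0Plus := by linarith [p.p0Plus_add_p1Plus]
    rw [h1, h2]
    ring

lemma tendsto_survival_snd (p : BernoulliPair) (h : 0 < p.pPlus1) (l : ℕ) :
    Tendsto (fun k => p.survival l k) atTop (𝓝 0) := by
  rw [← tendsto_add_atTop_iff_nat l]
  have h1 : p.pPlus0 < 1 := by linarith [p.pPlus0_add_pPlus1]
  have := (tendsto_pow_atTop_nhds_zero_of_lt_one p.pPlus0_nonneg h1).const_mul (p.p00 ^ l)
  rw [mul_zero] at this
  refine this.congr fun k => ?_
  rw [p.survival_of_le (by omega), Nat.add_sub_cancel]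

lemma tendsto_survival_fst (p : BernoulliPair) (h : 0 < p.p1Plus) (k : ℕ) :
    Tendsto (fun l => p.survival l k) atTop (𝓝 0) := by
  rw [← tendsto_add_atTop_iff_nat k]
  have h1 : p.p0Plus < 1 := by linarith [p.p0Plus_add_p1Plus]
  have := (tendsto_pow_atTop_nhds_zero_of_lt_one p.p0Plus_nonneg h1).const_mul (p.p00 ^ k)
  rw [mul_zero] at this
  refine this.congr fun l => ?_
  rw [p.survival_of_ge (by omega), Nat.add_sub_cancel]

end BernoulliPair

/-- Two null sequences with the same successive differences agree. -/
lemma eq_of_sub_succ_eq_of_tendsto_zero {f g : ℕ → ℝ} (hf : Tendsto f atTop (𝓝 0))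
    (hg : Tendsto g atTop (𝓝 0)) (h : ∀ n, f n - f (n + 1) = g n - g (n + 1)) (n : ℕ) :
    f n = g n := by
  have h1 : ∀ m, f m - g m = f 0 - g 0 := by
    intro m
    induction m with
    | zero => rfl
    | succ m ih => linarith [h m]
  have h2 : Tendsto (fun m => f m - g m) atTop (𝓝 0) := by simpa using hf.sub hg
  have h3 : f 0 - g 0 = 0 := by
    refine tendsto_nhds_unique (Tendsto.congr (fun m => (h1 m).symm) tendsto_const_nhds) h2
  linarith [h1 n]

variable {Ω : Type*} [MeasurableSpace Ω]

lemma tendsto_measureReal_le_nat (P : Measure Ω) [IsProbabilityMeasure P] {X : Ω → ℕ}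
    (hX : Measurable X) : Tendsto (fun k => P.real {ω | k ≤ X ω}) atTop (𝓝 0) := by
  have h : Tendsto (fun k => P {ω | k ≤ X ω}) atTop (𝓝 (P (⋂ k, {ω | k ≤ X ω}))) := by
    refine tendsto_measure_iInter_atTop
      (fun k => (measurableSet_le measurable_const hX).nullMeasurableSet) ?_
      ⟨0, measure_ne_top _ _⟩
    intro i j hij ω hω
    exact le_trans hij hω
  have h0 : (⋂ k, {ω | k ≤ X ω}) = ∅ := by
    ext ω
    simp only [Set.mem_iInter, Set.mem_ofPred_eq, Set.mem_empty_iff_false, iff_false, not_forall]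
    exact ⟨X ω + 1, by omega⟩
  rw [h0, measure_empty] at h
  exact (ENNReal.tendsto_toReal ENNReal.zero_ne_top).comp h

/-- `X` and `Y` have jointly the bivariate geometric law with parameter `p`. -/
structure HasBivGeomLaw (P : Measure Ω) (p : BernoulliPair) (X Y : Ω → ℕ) : Prop where
  measurable_fst : Measurable X
  measurable_snd : Measurable Y
  law : ∀ l k, P.real {ω | X ω = l ∧ Y ω = k} = bivGeomPMF p l k

lemma IsBivGeomArray.hasBivGeomLaw {P : Measure Ω} {p : ℕ → BernoulliPair}
    {ξ η : ℕ → ℕ → Ω → ℕ} (h : IsBivGeomArray P p ξ η) (n i : ℕ) :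
    HasBivGeomLaw P (p n) (ξ n i) (η n i) :=
  ⟨h.measurable_fst n i, h.measurable_snd n i, h.law n i⟩

namespace HasBivGeomLaw

variable {P : Measure Ω} [IsProbabilityMeasure P] {p : BernoulliPair} {X Y : Ω → ℕ}

/-- The total mass is 1. This excludes the degenerate parameters for which the formula of the law
vanishes identically, so `pPlus1` and `p1Plus` are positive. -/
lemma exists_pmf_ne_zero (h : HasBivGeomLaw P p X Y) : ∃ l k, bivGeomPMF p l k ≠ 0 := by
  by_contra! H
  have h1 : ∀ q : ℕ × ℕ, P {ω | X ω = q.1 ∧ Y ω = q.2} = 0 := by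
    intro q
    have := h.law q.1 q.2
    rw [H] at this
    exact (measureReal_eq_zero_iff (measure_ne_top _ _)).1 this
  have h2 := measure_iUnion_null h1
  have h3 : (⋃ q : ℕ × ℕ, {ω | X ω = q.1 ∧ Y ω = q.2}) = Set.univ := by
    ext ω
    simp
  rw [h3, measure_univ] at h2
  exact one_ne_zero h2

lemma pPlus1_pos (h : HasBivGeomLaw P p X Y) : 0 < p.pPlus1 := by
  refine lt_of_le_of_ne p.pPlus1_nonneg fun h0 => ?_
  obtain ⟨l, k, hlk⟩ := h.exists_pmf_ne_zero
  have h01 := p.p01_nonneg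
  have h11 := p.p11_nonneg
  have hs : p.p01 + p.p11 = 0 := h0.symm
  have h1 : p.p01 = 0 := by linarith
  have h2 : p.p11 = 0 := by linarith
  exact hlk (by simp [bivGeomPMF, ← h0, h1, h2])

lemma p1Plus_pos (h : HasBivGeomLaw P p X Y) : 0 < p.p1Plus := by
  refine lt_of_le_of_ne p.p1Plus_nonneg fun h0 => ?_
  obtain ⟨l, k, hlk⟩ := h.exists_pmf_ne_zero
  have h01 := p.p10_nonneg
  have h11 := p.p11_nonneg
  have hs : p.p10 + p.p11 = 0 := h0.symm
  have h1 : p.p10 = 0 := by linarith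
  have h2 : p.p11 = 0 := by linarith
  exact hlk (by simp [bivGeomPMF, ← h0, h1, h2])

/-- Tail summation in `k`: both sides tend to 0 and have the same successive differences.
`measureReal_le_and_le` repeats this in `l`. -/
lemma measureReal_eq_and_le (h : HasBivGeomLaw P p X Y) (l k : ℕ) :
    P.real {ω | X ω = l ∧ k ≤ Y ω} = p.survival l k - p.survival (l + 1) k := by
  refine eq_of_sub_succ_eq_of_tendsto_zero (f := fun k => P.real {ω | X ω = l ∧ k ≤ Y ω})
    (g := fun k => p.survival l k - p.survival (l + 1) k) ?_ ?_ ?_ k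
  · refine squeeze_zero (fun _ => measureReal_nonneg) (fun k => measureReal_mono ?_)
      (tendsto_measureReal_le_nat P h.measurable_snd)
    exact fun ω hω => hω.2
  · simpa using (p.tendsto_survival_snd h.pPlus1_pos l).sub
      (p.tendsto_survival_snd h.pPlus1_pos (l + 1))
  · intro k
    rw [p.survival_mixed_difference, ← h.law l k]
    have hm : MeasurableSet {ω | X ω = l ∧ Y ω = k} :=
      (h.measurable_fst (measurableSet_singleton l)).inter
        (h.measurable_snd (measurableSet_singleton k))
    have hu : {ω | X ω = l ∧ k ≤ Y ω} =
        {ω | X ω = l ∧ k + 1 ≤ Y ω} ∪ {ω | X ω = l ∧ Y ω = k} := by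
      ext ω
      simp only [Set.mem_ofPred_eq, Set.mem_union]
      omega
    rw [hu, measureReal_union _ hm]
    · ring
    · rw [Set.disjoint_left]
      intro ω h1 h2
      have := h1.2
      have := h2.2
      omega

lemma measureReal_le_and_le (h : HasBivGeomLaw P p X Y) (l k : ℕ) :
    P.real {ω | l ≤ X ω ∧ k ≤ Y ω} = p.survival l k := by
  refine eq_of_sub_succ_eq_of_tendsto_zero (f := fun l => P.real {ω | l ≤ X ω ∧ k ≤ Y ω})
    (g := fun l => p.survival l k) ?_ (p.tendsto_survival_fst h.p1Plus_pos k) ?_ l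
  · refine squeeze_zero (fun _ => measureReal_nonneg) (fun l => measureReal_mono ?_)
      (tendsto_measureReal_le_nat P h.measurable_fst)
    exact fun ω hω => hω.1
  · intro l
    rw [← h.measureReal_eq_and_le l k]
    have hm : MeasurableSet {ω | X ω = l ∧ k ≤ Y ω} :=
      (h.measurable_fst (measurableSet_singleton l)).inter
        (measurableSet_le measurable_const h.measurable_snd)
    have hu : {ω | l ≤ X ω ∧ k ≤ Y ω} =
        {ω | l + 1 ≤ X ω ∧ k ≤ Y ω} ∪ {ω | X ω = l ∧ k ≤ Y ω} := by
      ext ω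
      simp only [Set.mem_ofPred_eq, Set.mem_union]
      omega
    rw [hu, measureReal_union _ hm]
    · ring
    · rw [Set.disjoint_left]
      intro ω h1 h2
      have := h1.1
      have := h2.1
      omega

lemma measure_le_and_le (h : HasBivGeomLaw P p X Y) (l k : ℕ) :
    P {ω | l ≤ X ω ∧ k ≤ Y ω} = ENNReal.ofReal (p.survival l k) := by
  rw [← h.measureReal_le_and_le, ofReal_measureReal]

/-- Layer-cake formula for a natural number: `f 0 + ⋯ + f (X - 1)`, on the event `k ≤ Y`. -/
lemma lintegral_sum_range_indicator (h : HasBivGeomLaw P p X Y) (f : ℕ → ENNReal) (k : ℕ) :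
    ∫⁻ ω, {ω | k ≤ Y ω}.indicator (fun ω => ∑ l ∈ Finset.range (X ω), f l) ω ∂P
      = ∑' l, f l * ENNReal.ofReal (p.survival (l + 1) k) := by
  have hm : ∀ l, MeasurableSet {ω | l + 1 ≤ X ω ∧ k ≤ Y ω} := fun l =>
    (measurableSet_le measurable_const h.measurable_fst).inter
      (measurableSet_le measurable_const h.measurable_snd)
  have h1 : ∀ ω, {ω | k ≤ Y ω}.indicator (fun ω => ∑ l ∈ Finset.range (X ω), f l) ω
      = ∑' l, {ω | l + 1 ≤ X ω ∧ k ≤ Y ω}.indicator (fun _ => f l) ω := by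
    intro ω
    rw [tsum_eq_sum (s := Finset.range (X ω))]
    · by_cases hk : k ≤ Y ω
      · rw [Set.indicator_of_mem (by exact hk)]
        refine Finset.sum_congr rfl fun l hl => ?_
        rw [Set.indicator_of_mem]
        exact ⟨Finset.mem_range.1 hl, hk⟩
      · rw [Set.indicator_of_notMem (by exact hk)]
        refine (Finset.sum_eq_zero fun l hl => ?_).symm
        rw [Set.indicator_of_notMem]
        exact fun hh => hk hh.2
    · intro l hl
      rw [Set.indicator_of_notMem]
      intro hh
      exact hl (Finset.mem_range.2 hh.1)
  simp_rw [h1]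
  rw [lintegral_tsum (fun l => (measurable_const.indicator (hm l)).aemeasurable)]
  refine tsum_congr fun l => ?_
  rw [lintegral_indicator_const (hm l), h.measure_le_and_le]

/-- `E ξ = p₀₊ / p₁₊`. -/
lemma lintegral_fst (h : HasBivGeomLaw P p X Y) :
    ∫⁻ ω, (X ω : ENNReal) ∂P = ENNReal.ofReal (p.p0Plus / p.p1Plus) := by
  have h1 := h.lintegral_sum_range_indicator (fun _ => 1) 0
  simp only [Nat.zero_le, Set.ofPred_true, Set.indicator_univ, Finset.sum_const, Finset.card_range,
    nsmul_eq_mul, mul_one, one_mul] at h1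
  have hlt : p.p0Plus < 1 := by linarith [p.p0Plus_add_p1Plus, h.p1Plus_pos]
  have hs := (hasSum_geometric_of_lt_one p.p0Plus_nonneg hlt).mul_left p.p0Plus
  rw [h1, show p.p0Plus / p.p1Plus = p.p0Plus * (1 - p.p0Plus)⁻¹ by
    rw [div_eq_mul_inv, ← p.p0Plus_add_p1Plus, add_sub_cancel_left], ← hs.tsum_eq,
    ENNReal.ofReal_tsum_of_nonneg (fun n => mul_nonneg p.p0Plus_nonneg
      (pow_nonneg p.p0Plus_nonneg n)) hs.summable]
  refine tsum_congr fun l => ?_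
  rw [p.survival_of_ge (by omega)]
  simp [pow_succ']

/-- `E ξ 1{η ≥ 1} = p₀₀ / p₁₊`. -/
lemma lintegral_fst_indicator (h : HasBivGeomLaw P p X Y) :
    ∫⁻ ω, {ω | 1 ≤ Y ω}.indicator (fun ω => (X ω : ENNReal)) ω ∂P
      = ENNReal.ofReal (p.p00 / p.p1Plus) := by
  have h1 := h.lintegral_sum_range_indicator (fun _ => 1) 1
  simp only [Finset.sum_const, Finset.card_range, nsmul_eq_mul, mul_one, one_mul] at h1
  have hlt : p.p0Plus < 1 := by linarith [p.p0Plus_add_p1Plus, h.p1Plus_pos]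
  have hs := (hasSum_geometric_of_lt_one p.p0Plus_nonneg hlt).mul_left p.p00
  rw [h1, show p.p00 / p.p1Plus = p.p00 * (1 - p.p0Plus)⁻¹ by
    rw [div_eq_mul_inv, ← p.p0Plus_add_p1Plus, add_sub_cancel_left], ← hs.tsum_eq,
    ENNReal.ofReal_tsum_of_nonneg (fun n => mul_nonneg p.p00_nonneg
      (pow_nonneg p.p0Plus_nonneg n)) hs.summable]
  refine tsum_congr fun l => ?_
  rw [p.survival_of_ge (by omega)]
  simp

/-- `E ξ² ≤ 2 / p₁₊²`. -/
lemma lintegral_fst_sq_le (h : HasBivGeomLaw P p X Y) :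
    ∫⁻ ω, (X ω : ENNReal) ^ 2 ∂P ≤ ENNReal.ofReal (2 / p.p1Plus ^ 2) := by
  have h1 := h.lintegral_sum_range_indicator (fun l => 2 * ((l + 1 : ℕ) : ENNReal)) 0
  simp only [Nat.zero_le, Set.ofPred_true, Set.indicator_univ] at h1
  -- The sum equals `m (m + 1)`, which the layer-cake formula turns into a derivative of the
  -- geometric series.
  have hle : ∀ m : ℕ, m ^ 2 ≤ ∑ l ∈ Finset.range m, 2 * (l + 1) := by
    intro m
    induction m with
    | zero => simp
    | succ m ih => rw [Finset.sum_range_succ]; nlinarith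
  have hlt : p.p0Plus < 1 := by linarith [p.p0Plus_add_p1Plus, h.p1Plus_pos]
  have h0 := p.p0Plus_nonneg
  have hn : ‖p.p0Plus‖ < 1 := by rwa [Real.norm_of_nonneg h0]
  have hs : HasSum (fun l : ℕ => 2 * (((l + 1 : ℕ) : ℝ) * p.p0Plus ^ (l + 1)))
      (2 * (p.p0Plus / (1 - p.p0Plus) ^ 2)) := by
    have := ((hasSum_nat_add_iff' (f := fun l : ℕ => (l : ℝ) * p.p0Plus ^ l) 1).2
      (hasSum_coe_mul_geometric_of_norm_lt_one hn)).mul_left 2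
    rwa [Finset.sum_range_one, Nat.cast_zero, zero_mul, sub_zero] at this
  calc ∫⁻ ω, (X ω : ENNReal) ^ 2 ∂P
      ≤ ∫⁻ ω, ∑ l ∈ Finset.range (X ω), 2 * ((l + 1 : ℕ) : ENNReal) ∂P :=
        lintegral_mono fun ω => by
          have := (Nat.cast_le (α := ENNReal)).2 (hle (X ω))
          push_cast at this ⊢
          exact this
    _ = ENNReal.ofReal (2 * (p.p0Plus / (1 - p.p0Plus) ^ 2)) := by
        rw [h1, ← hs.tsum_eq, ENNReal.ofReal_tsum_of_nonneg (fun n => by positivity) hs.summable]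
        refine tsum_congr fun l => ?_
        rw [p.survival_of_ge (by omega), pow_zero, one_mul, Nat.sub_zero, ← mul_assoc,
          ENNReal.ofReal_mul (by positivity), ENNReal.ofReal_mul (by positivity)]
        simp only [ENNReal.ofReal_natCast, ENNReal.ofReal_ofNat]
    _ ≤ ENNReal.ofReal (2 / p.p1Plus ^ 2) := by
        refine ENNReal.ofReal_le_ofReal ?_
        rw [show 1 - p.p0Plus = p.p1Plus by linarith [p.p0Plus_add_p1Plus], mul_div_assoc']
        have := h.p1Plus_pos
        gcongr
        linarith

/-- `E ξ 1{η = 0} = p₀₁ / p₁₊`. -/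
lemma lintegral_fst_indicator_compl (h : HasBivGeomLaw P p X Y) :
    ∫⁻ ω, {ω | 1 ≤ Y ω}ᶜ.indicator (fun ω => (X ω : ENNReal)) ω ∂P
      = ENNReal.ofReal (p.p01 / p.p1Plus) := by
  have hm : MeasurableSet {ω | 1 ≤ Y ω} := measurableSet_le measurable_const h.measurable_snd
  have h1 := lintegral_add_compl (μ := P) (fun ω => (X ω : ENNReal)) hm
  rw [← lintegral_indicator hm, ← lintegral_indicator hm.compl, h.lintegral_fst_indicator,
    h.lintegral_fst, show p.p0Plus / p.p1Plus = p.p00 / p.p1Plus + p.p01 / p.p1Plus by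
      rw [BernoulliPair.p0Plus, add_div],
    ENNReal.ofReal_add (div_nonneg p.p00_nonneg p.p1Plus_nonneg)
      (div_nonneg p.p01_nonneg p.p1Plus_nonneg)] at h1
  exact (ENNReal.add_right_inj ENNReal.ofReal_ne_top).1 h1

/-- Inclusion-exclusion for the distribution function. -/
lemma measureReal_le_le (h : HasBivGeomLaw P p X Y) (l k : ℕ) :
    P.real {ω | X ω ≤ l ∧ Y ω ≤ k} =
      1 - (p.p0Plus ^ (l + 1) + p.pPlus0 ^ (k + 1) - p.survival (l + 1) (k + 1)) := by
  have hA : MeasurableSet {ω | l + 1 ≤ X ω} := measurableSet_le measurable_const h.measurable_fst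
  have hB : MeasurableSet {ω | k + 1 ≤ Y ω} := measurableSet_le measurable_const h.measurable_snd
  have h1 := measureReal_union_add_inter (μ := P) (s := {ω | l + 1 ≤ X ω}) hB
  have h2 : {ω | X ω ≤ l ∧ Y ω ≤ k} = ({ω | l + 1 ≤ X ω} ∪ {ω | k + 1 ≤ Y ω})ᶜ := by
    ext ω
    simp only [Set.mem_ofPred_eq, Set.mem_compl_iff, Set.mem_union]
    omega
  have h3 : P.real ({ω | l + 1 ≤ X ω} ∩ {ω | k + 1 ≤ Y ω}) = p.survival (l + 1) (k + 1) :=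
    h.measureReal_le_and_le (l + 1) (k + 1)
  have h4 : P.real {ω | l + 1 ≤ X ω} = p.p0Plus ^ (l + 1) := by
    have := h.measureReal_le_and_le (l + 1) 0
    rw [p.survival_of_ge (by omega)] at this
    simpa using this
  have h5 : P.real {ω | k + 1 ≤ Y ω} = p.pPlus0 ^ (k + 1) := by
    have := h.measureReal_le_and_le 0 (k + 1)
    rw [p.survival_of_le (by omega)] at this
    simpa using this
  rw [h2, measureReal_compl (hA.union hB), probReal_univ]
  linarith

end HasBivGeomLaw

end BisexualBranching

/-! ### Independence of a generation's size and its offspring vectors. -/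

namespace BisexualBranching

variable {Ω : Type*}

/-- The offspring vectors of generation `n`. -/
def offspring (ξ η : ℕ → ℕ → Ω → ℕ) (n : ℕ) (ω : Ω) : ℕ → ℕ × ℕ := fun i => (ξ n i ω, η n i ω)

lemma measurable_offspring [MeasurableSpace Ω] {ξ η : ℕ → ℕ → Ω → ℕ} {n : ℕ}
    (h : ∀ i, Measurable (fun ω => (ξ n i ω, η n i ω))) : Measurable (offspring ξ η n) :=
  measurable_pi_lambda _ h

lemma measurable_of_measurable_fiber {α β : Type*} [MeasurableSpace α] [MeasurableSpace β]
    {F : ℕ → α → β} (hF : ∀ j, Measurable (F j)) : Measurable (fun q : ℕ × α => F q.1 q.2) :=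
  measurable_from_prod_countable_right hF

/-- Number of mating units formed by the offspring `v 0, …, v (j - 1)`. -/
def nextSize (L : ℕ → ℕ → ℕ) (j : ℕ) (v : ℕ → ℕ × ℕ) : ℕ :=
  L (∑ i ∈ Finset.range j, (v i).1) (∑ i ∈ Finset.range j, (v i).2)

lemma measurable_nextSize (L : ℕ → ℕ → ℕ) (j : ℕ) : Measurable (nextSize L j) := by
  have h2 : Measurable (fun q : ℕ × ℕ => L q.1 q.2) := measurable_of_countable _
  exact h2.comp (f := fun v : ℕ → ℕ × ℕ => (∑ i ∈ Finset.range j, (v i).1,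
    ∑ i ∈ Finset.range j, (v i).2)) (by fun_prop)

lemma process_succ (L : ℕ → ℕ → ℕ) (N : ℕ) (ξ η : ℕ → ℕ → Ω → ℕ) (n : ℕ) (ω : Ω) :
    process L N ξ η (n + 1) ω = nextSize L (process L N ξ η n ω) (offspring ξ η n ω) := rfl

lemma measurable_process_succ [MeasurableSpace Ω] (L : ℕ → ℕ → ℕ) (N : ℕ)
    {ξ η : ℕ → ℕ → Ω → ℕ} {n : ℕ} (hZ : Measurable (process L N ξ η n))
    (h : ∀ i, Measurable (fun ω => (ξ n i ω, η n i ω))) :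
    Measurable (process L N ξ η (n + 1)) :=
  (measurable_of_measurable_fiber (measurable_nextSize L)).comp
    (hZ.prodMk (measurable_offspring h))

/-- Only generations before `n` are assumed measurable, so that the lemma also applies to the
σ-algebra which they generate. -/
lemma measurable_process_of_lt [MeasurableSpace Ω] (L : ℕ → ℕ → ℕ) (N : ℕ)
    {ξ η : ℕ → ℕ → Ω → ℕ} {n : ℕ}
    (h : ∀ m < n, ∀ i, Measurable (fun ω => (ξ m i ω, η m i ω))) :
    Measurable (process L N ξ η n) := by
  induction n with
  | zero => exact measurable_const
  | succ n ih =>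
    exact measurable_process_succ L N (ih fun m hm => h m (by omega)) (h n (by omega))

namespace IsBivGeomArray

variable [MeasurableSpace Ω] {P : Measure Ω} {p : ℕ → BernoulliPair} {ξ η : ℕ → ℕ → Ω → ℕ}

lemma measurable_pair (h : IsBivGeomArray P p ξ η) (n i : ℕ) :
    Measurable (fun ω => (ξ n i ω, η n i ω)) :=
  (h.measurable_fst n i).prodMk (h.measurable_snd n i)

lemma measurable_process (h : IsBivGeomArray P p ξ η) (L : ℕ → ℕ → ℕ) (N n : ℕ) :
    Measurable (process L N ξ η n) :=
  measurable_process_of_lt L N fun m _ i => h.measurable_pair m i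

/-- The size of generation `n` is independent of the offspring vectors of generation `n`. -/
lemma indepFun_process_offspring (h : IsBivGeomArray P p ξ η) (L : ℕ → ℕ → ℕ) (N n : ℕ) :
    IndepFun (process L N ξ η n) (offspring ξ η n) P := by
  -- `Z n` depends on the rows before `n` only; disjoint blocks of an independent family generate
  -- independent σ-algebras.
  have hdis : Disjoint {t : ℕ × ℕ | t.1 < n} {t : ℕ × ℕ | t.1 = n} := by
    rw [Set.disjoint_left]
    intro t h1 h2
    exact absurd h2 (ne_of_lt h1)
  have hle : ∀ t : ℕ × ℕ, MeasurableSpace.comap (fun ω => (ξ t.1 t.2 ω, η t.1 t.2 ω))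
      inferInstance ≤ ‹MeasurableSpace Ω› := fun t => (h.measurable_pair t.1 t.2).comap_le
  have key := indep_iSup_of_disjoint hle h.indep.iIndep hdis
  rw [IndepFun_iff_Indep]
  have hmeas : ∀ (S : Set (ℕ × ℕ)) (t : ℕ × ℕ), t ∈ S →
      Measurable[⨆ t ∈ S, MeasurableSpace.comap (fun ω => (ξ t.1 t.2 ω, η t.1 t.2 ω))
        inferInstance] (fun ω => (ξ t.1 t.2 ω, η t.1 t.2 ω)) := by
    intro S t ht
    rw [measurable_iff_comap_le]
    exact le_iSup₂_of_le t ht le_rfl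
  refine indep_of_indep_of_le_left (indep_of_indep_of_le_right key ?_) ?_
  · rw [← measurable_iff_comap_le]
    exact @measurable_offspring Ω (_) ξ η n fun i => hmeas _ (n, i) rfl
  · rw [← measurable_iff_comap_le]
    exact @measurable_process_of_lt Ω (_) L N ξ η n fun m hm i => hmeas _ (m, i) hm

/-- Conditioning on `Z n` in the form of Fubini's theorem: the random number of units may be frozen
while the offspring are averaged. -/
lemma lintegral_process_offspring [IsProbabilityMeasure P] (h : IsBivGeomArray P p ξ η)
    (L : ℕ → ℕ → ℕ) (N n : ℕ) {F : ℕ → (ℕ → ℕ × ℕ) → ENNReal} (hF : ∀ j, Measurable (F j)) :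
    ∫⁻ ω, F (process L N ξ η n ω) (offspring ξ η n ω) ∂P
      = ∫⁻ ω, ∫⁻ ω', F (process L N ξ η n ω) (offspring ξ η n ω') ∂P ∂P := by
  have hZ := h.measurable_process L N n
  have hV : Measurable (offspring ξ η n) := measurable_offspring (h.measurable_pair n)
  have hmap := (h.indepFun_process_offspring L N n).map_prod_eq_prod_map_map hZ.aemeasurable
    hV.aemeasurable
  have hFm := measurable_of_measurable_fiber hF
  have : SFinite (P.map (offspring ξ η n)) := by
    have := Measure.isProbabilityMeasure_map (μ := P) hV.aemeasurable
    infer_instance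
  rw [← lintegral_map (f := fun q : ℕ × (ℕ → ℕ × ℕ) => F q.1 q.2) hFm (hZ.prodMk hV), hmap,
    lintegral_prod _ hFm.aemeasurable,
    lintegral_map (measurable_of_countable _) hZ]
  refine lintegral_congr fun ω => ?_
  rw [lintegral_map (hF _) hV]

lemma indepFun_row (h : IsBivGeomArray P p ξ η) (n : ℕ) :
    iIndepFun (fun i ω => (ξ n i ω, η n i ω)) P :=
  h.indep.precomp (g := fun i => (n, i)) fun _ _ hij => (Prod.mk.inj hij).2

end IsBivGeomArray

end BisexualBranching

/-! ### One generation: females with and without brothers. -/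

namespace BisexualBranching

/-- Number of females among the offspring `q` of one mating unit that has male offspring. -/
def matedFemales (q : ℕ × ℕ) : ℕ := if 1 ≤ q.2 then q.1 else 0

/-- Number of females among the offspring `q` of one mating unit without male offspring. -/
def brotherlessFemales (q : ℕ × ℕ) : ℕ := if 1 ≤ q.2 then 0 else q.1

lemma matedFemales_add_brotherlessFemales (q : ℕ × ℕ) :
    matedFemales q + brotherlessFemales q = q.1 := by
  unfold matedFemales brotherlessFemales
  split_ifs <;> simp

/-- If there are no males, no female has a brother; if there is one male, all females mate. -/
lemma sum_matedFemales_le_nextSize (j : ℕ) (v : ℕ → ℕ × ℕ) :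
    ∑ i ∈ Finset.range j, matedFemales (v i) ≤ nextSize promiscuous j v := by
  unfold nextSize promiscuous
  rcases Nat.eq_zero_or_pos (∑ i ∈ Finset.range j, (v i).2) with h | h
  · rw [h]
    simp only [zero_le, inf_of_le_right, mul_zero, nonpos_iff_eq_zero]
    refine Finset.sum_eq_zero fun i hi => ?_
    have := Finset.sum_eq_zero_iff.1 h i hi
    simp [matedFemales, this]
  · rw [min_eq_left h, mul_one]
    refine Finset.sum_le_sum fun i _ => ?_
    have := matedFemales_add_brotherlessFemales (v i)
    omega

lemma nextSize_le (j : ℕ) (v : ℕ → ℕ × ℕ) :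
    nextSize promiscuous j v ≤ ∑ i ∈ Finset.range j, matedFemales (v i)
      + ∑ i ∈ Finset.range j, brotherlessFemales (v i) := by
  rw [← Finset.sum_add_distrib]
  simp_rw [matedFemales_add_brotherlessFemales]
  unfold nextSize promiscuous
  exact mul_le_of_le_one_right (Nat.zero_le _) (min_le_left _ _)

/-- Separates the independent sum, controlled by its variance, from the nonlinearity of the mating
function, controlled by a mean. -/
lemma abs_nextSize_sub_le (j : ℕ) (v : ℕ → ℕ × ℕ) (x : ℝ) :
    |(nextSize promiscuous j v : ℝ) - x| ≤ |(∑ i ∈ Finset.range j, (matedFemales (v i) : ℝ)) - x|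
      + ((∑ i ∈ Finset.range j, brotherlessFemales (v i) : ℕ) : ℝ) := by
  have h1 : ((∑ i ∈ Finset.range j, matedFemales (v i) : ℕ) : ℝ) ≤ nextSize promiscuous j v := by
    exact_mod_cast sum_matedFemales_le_nextSize j v
  have h2 : (nextSize promiscuous j v : ℝ) ≤ ((∑ i ∈ Finset.range j, matedFemales (v i) : ℕ) : ℝ)
      + ((∑ i ∈ Finset.range j, brotherlessFemales (v i) : ℕ) : ℝ) := by
    exact_mod_cast nextSize_le j v
  rw [← Nat.cast_sum]
  set A := ((∑ i ∈ Finset.range j, matedFemales (v i) : ℕ) : ℝ)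
  have h3 := abs_sub_le (nextSize promiscuous j v : ℝ) A x
  rw [abs_of_nonneg (by linarith : 0 ≤ (nextSize promiscuous j v : ℝ) - A)] at h3
  linarith

lemma measurable_matedFemales : Measurable matedFemales := measurable_of_countable _

lemma measurable_brotherlessFemales : Measurable brotherlessFemales := measurable_of_countable _

variable {Ω : Type*} [MeasurableSpace Ω]

namespace HasBivGeomLaw

variable {P : Measure Ω} [IsProbabilityMeasure P] {p : BernoulliPair} {X Y : Ω → ℕ}

lemma lintegral_matedFemales (h : HasBivGeomLaw P p X Y) :
    ∫⁻ ω, (matedFemales (X ω, Y ω) : ENNReal) ∂P = ENNReal.ofReal (p.p00 / p.p1Plus) := by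
  rw [← h.lintegral_fst_indicator]
  refine lintegral_congr fun ω => ?_
  by_cases hy : 1 ≤ Y ω <;> simp [matedFemales, Set.indicator, hy]

lemma lintegral_brotherlessFemales (h : HasBivGeomLaw P p X Y) :
    ∫⁻ ω, (brotherlessFemales (X ω, Y ω) : ENNReal) ∂P = ENNReal.ofReal (p.p01 / p.p1Plus) := by
  rw [← h.lintegral_fst_indicator_compl]
  refine lintegral_congr fun ω => ?_
  by_cases hy : 1 ≤ Y ω <;> simp [brotherlessFemales, Set.indicator, hy]

omit [IsProbabilityMeasure P] in
lemma measurable_matedFemales_comp (h : HasBivGeomLaw P p X Y) :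
    Measurable (fun ω => (matedFemales (X ω, Y ω) : ℝ)) :=
  measurable_from_nat.comp (measurable_matedFemales.comp
    (h.measurable_fst.prodMk h.measurable_snd))

lemma integral_matedFemales (h : HasBivGeomLaw P p X Y) :
    ∫ ω, (matedFemales (X ω, Y ω) : ℝ) ∂P = p.p00 / p.p1Plus := by
  rw [integral_eq_lintegral_of_nonneg_ae (ae_of_all _ fun ω => Nat.cast_nonneg _)
    h.measurable_matedFemales_comp.aestronglyMeasurable]
  simp_rw [ENNReal.ofReal_natCast]
  rw [h.lintegral_matedFemales, ENNReal.toReal_ofReal (div_nonneg p.p00_nonneg p.p1Plus_nonneg)]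

lemma lintegral_matedFemales_sq_le (h : HasBivGeomLaw P p X Y) :
    ∫⁻ ω, ENNReal.ofReal ((matedFemales (X ω, Y ω) : ℝ) ^ 2) ∂P
      ≤ ENNReal.ofReal (2 / p.p1Plus ^ 2) := by
  refine le_trans (lintegral_mono fun ω => ?_) h.lintegral_fst_sq_le
  rw [ENNReal.ofReal_pow (Nat.cast_nonneg _), ENNReal.ofReal_natCast]
  have : matedFemales (X ω, Y ω) ≤ X ω := by
    have := matedFemales_add_brotherlessFemales (X ω, Y ω)
    simp only at this
    omega
  gcongr

lemma memLp_matedFemales (h : HasBivGeomLaw P p X Y) :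
    MemLp (fun ω => (matedFemales (X ω, Y ω) : ℝ)) 2 P := by
  rw [memLp_two_iff_integrable_sq h.measurable_matedFemales_comp.aestronglyMeasurable]
  refine ⟨(h.measurable_matedFemales_comp.pow_const 2).aestronglyMeasurable, ?_⟩
  rw [hasFiniteIntegral_iff_ofReal (ae_of_all _ fun ω => sq_nonneg _)]
  exact h.lintegral_matedFemales_sq_le.trans_lt ENNReal.ofReal_lt_top

lemma variance_matedFemales_le (h : HasBivGeomLaw P p X Y) :
    variance (fun ω => (matedFemales (X ω, Y ω) : ℝ)) P ≤ 2 / p.p1Plus ^ 2 := by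
  refine (variance_le_expectation_sq
    h.measurable_matedFemales_comp.aestronglyMeasurable).trans ?_
  simp only [Pi.pow_apply]
  rw [integral_eq_lintegral_of_nonneg_ae (ae_of_all _ fun ω => sq_nonneg _)
    (h.measurable_matedFemales_comp.pow_const 2).aestronglyMeasurable]
  refine (ENNReal.toReal_mono ENNReal.ofReal_ne_top h.lintegral_matedFemales_sq_le).trans ?_
  rw [ENNReal.toReal_ofReal (by positivity)]

end HasBivGeomLaw

namespace IsBivGeomArray

variable {P : Measure Ω} [IsProbabilityMeasure P] {p : ℕ → BernoulliPair} {ξ η : ℕ → ℕ → Ω → ℕ}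

/-- For a single unit, `L (ξ, η) = ξ 1{η ≥ 1}` counts exactly the females with a brother. -/
lemma growthRate_one (h : IsBivGeomArray P p ξ η) (n : ℕ) :
    growthRate P promiscuous ξ η n 1 = (p n).p00 / (p n).p1Plus := by
  rw [← (h.hasBivGeomLaw n 0).integral_matedFemales, growthRate, Nat.cast_one, inv_one, one_mul]
  refine integral_congr_ae (ae_of_all _ fun ω => ?_)
  simp only [Finset.sum_range_one, promiscuous, matedFemales]
  by_cases hy : 1 ≤ η n 0 ω
  · simp [hy]
  · have : η n 0 ω = 0 := by omega
    simp [this]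

lemma meanGrowth_succ (h : IsBivGeomArray P p ξ η) (n : ℕ) :
    meanGrowth P promiscuous ξ η (n + 1)
      = meanGrowth P promiscuous ξ η n * ((p n).p00 / (p n).p1Plus) := by
  rw [meanGrowth, Finset.prod_range_succ, h.growthRate_one, meanGrowth]

lemma lintegral_sum_matedFemales (h : IsBivGeomArray P p ξ η) (n j : ℕ) :
    ∫⁻ ω, ((∑ i ∈ Finset.range j, matedFemales (offspring ξ η n ω i) : ℕ) : ENNReal) ∂P
      = j * ENNReal.ofReal ((p n).p00 / (p n).p1Plus) := by
  push_cast
  rw [lintegral_finsetSum]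
  · simp only [offspring, (h.hasBivGeomLaw n _).lintegral_matedFemales, Finset.sum_const,
      Finset.card_range, nsmul_eq_mul]
  · exact fun i _ => measurable_from_nat.comp (measurable_matedFemales.comp (h.measurable_pair n i))

lemma lintegral_sum_brotherlessFemales (h : IsBivGeomArray P p ξ η) (n j : ℕ) :
    ∫⁻ ω, ((∑ i ∈ Finset.range j, brotherlessFemales (offspring ξ η n ω i) : ℕ) : ENNReal) ∂P
      = j * ENNReal.ofReal ((p n).p01 / (p n).p1Plus) := by
  push_cast
  rw [lintegral_finsetSum]
  · simp only [offspring, (h.hasBivGeomLaw n _).lintegral_brotherlessFemales, Finset.sum_const,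
      Finset.card_range, nsmul_eq_mul]
  · exact fun i _ => measurable_from_nat.comp
      (measurable_brotherlessFemales.comp (h.measurable_pair n i))

lemma variance_sum_matedFemales_le (h : IsBivGeomArray P p ξ η) (n j : ℕ) :
    variance (∑ i ∈ Finset.range j, fun ω => (matedFemales (ξ n i ω, η n i ω) : ℝ)) P
      ≤ j * (2 / (p n).p1Plus ^ 2) := by
  have hm : Measurable (fun q : ℕ × ℕ => (matedFemales q : ℝ)) := measurable_of_countable _
  rw [IndepFun.variance_sum (fun i _ => (h.hasBivGeomLaw n i).memLp_matedFemales)]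
  · refine (Finset.sum_le_card_nsmul _ _ _ fun i _ =>
      (h.hasBivGeomLaw n i).variance_matedFemales_le).trans ?_
    simp
  · intro i _ j _ hij
    exact ((h.indepFun_row n).indepFun hij).comp hm hm

/-- First absolute moment of the fluctuations, from the variance by `2|x| ≤ t x² + 1/t`. -/
lemma lintegral_abs_sum_matedFemales_sub_le (h : IsBivGeomArray P p ξ η) (n j : ℕ) {t : ℝ}
    (ht : 0 < t) :
    ∫⁻ ω, ENNReal.ofReal |(∑ i ∈ Finset.range j, (matedFemales (offspring ξ η n ω i) : ℝ))
        - (p n).p00 / (p n).p1Plus * j| ∂P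
      ≤ j * ENNReal.ofReal (t / (p n).p1Plus ^ 2) + ENNReal.ofReal (1 / (2 * t)) := by
  set S : Ω → ℝ := ∑ i ∈ Finset.range j, fun ω => (matedFemales (ξ n i ω, η n i ω) : ℝ) with hS
  set r := (p n).p00 / (p n).p1Plus with hr
  have hSL : MemLp S 2 P := memLp_finsetSum' _ fun i _ => (h.hasBivGeomLaw n i).memLp_matedFemales
  have hSE : ∫ ω, S ω ∂P = r * j := by
    simp only [hS, Finset.sum_apply]
    rw [integral_finsetSum _ fun i _ =>
      (h.hasBivGeomLaw n i).memLp_matedFemales.integrable one_le_two]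
    simp only [(h.hasBivGeomLaw n _).integral_matedFemales, Finset.sum_const, Finset.card_range,
      nsmul_eq_mul]
    rw [mul_comm]
  have hV := h.variance_sum_matedFemales_le n j
  rw [← hS, variance_eq_integral hSL.aestronglyMeasurable.aemeasurable, hSE] at hV
  have hI : Integrable (fun ω => (S ω - r * j) ^ 2) P :=
    (hSL.sub (memLp_const (r * j))).integrable_sq
  have hVL : ∫⁻ ω, ENNReal.ofReal ((S ω - r * j) ^ 2) ∂P
      ≤ ENNReal.ofReal (j * (2 / (p n).p1Plus ^ 2)) := by
    rw [← ofReal_integral_eq_lintegral_ofReal hI (ae_of_all _ fun ω => sq_nonneg _)]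
    exact ENNReal.ofReal_le_ofReal hV
  have hpt : ∀ y : ℝ, ENNReal.ofReal |y|
      ≤ ENNReal.ofReal (t / 2) * ENNReal.ofReal (y ^ 2) + ENNReal.ofReal (1 / (2 * t)) := by
    intro y
    rw [← ENNReal.ofReal_mul (by positivity),
      ← ENNReal.ofReal_add (by positivity) (by positivity)]
    refine ENNReal.ofReal_le_ofReal ?_
    have h1 : t / 2 * y ^ 2 + 1 / (2 * t) - |y| = (t * |y| - 1) ^ 2 / (2 * t) := by
      rw [← sq_abs y]
      field_simp
      ring
    have h2 : 0 ≤ (t * |y| - 1) ^ 2 / (2 * t) := by positivity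
    linarith
  calc _ = ∫⁻ ω, ENNReal.ofReal |S ω - r * j| ∂P := by
        refine lintegral_congr fun ω => ?_
        simp only [hS, Finset.sum_apply, offspring]
    _ ≤ ∫⁻ ω, (ENNReal.ofReal (t / 2) * ENNReal.ofReal ((S ω - r * j) ^ 2)
          + ENNReal.ofReal (1 / (2 * t))) ∂P := lintegral_mono fun ω => hpt _
    _ = ENNReal.ofReal (t / 2) * ∫⁻ ω, ENNReal.ofReal ((S ω - r * j) ^ 2) ∂P
          + ENNReal.ofReal (1 / (2 * t)) := by
        rw [lintegral_add_right _ measurable_const, lintegral_const, measure_univ, mul_one,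
          lintegral_const_mul' _ _ ENNReal.ofReal_ne_top]
    _ ≤ ENNReal.ofReal (t / 2) * ENNReal.ofReal (j * (2 / (p n).p1Plus ^ 2))
          + ENNReal.ofReal (1 / (2 * t)) := by gcongr
    _ = _ := by
        rw [← ENNReal.ofReal_mul (by positivity), ← ENNReal.ofReal_natCast j,
          ← ENNReal.ofReal_mul (by positivity)]
        congr 2
        ring

end IsBivGeomArray

end BisexualBranching

/-! ### Moment bounds and L¹ increments of the normalized process. -/

namespace BisexualBranching

variable {Ω : Type*} [MeasurableSpace Ω] {P : Measure Ω} [IsProbabilityMeasure P]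

namespace IsBivGeomArray

variable {p : ℕ → BernoulliPair} {ξ η : ℕ → ℕ → Ω → ℕ}

omit [IsProbabilityMeasure P] in
lemma measurable_process_cast (h : IsBivGeomArray P p ξ η) (N n : ℕ) :
    Measurable (fun ω => (process promiscuous N ξ η n ω : ENNReal)) :=
  measurable_from_nat.comp (h.measurable_process promiscuous N n)

lemma lintegral_process_succ_le (h : IsBivGeomArray P p ξ η) (N n : ℕ) :
    ∫⁻ ω, (process promiscuous N ξ η (n + 1) ω : ENNReal) ∂P
      ≤ (∫⁻ ω, (process promiscuous N ξ η n ω : ENNReal) ∂P)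
        * ENNReal.ofReal ((p n).p00 / (p n).p1Plus + (p n).p01 / (p n).p1Plus) := by
  simp_rw [process_succ]
  rw [h.lintegral_process_offspring promiscuous N n
    (F := fun j v => (nextSize promiscuous j v : ENNReal))
    (fun j => measurable_from_nat.comp (measurable_nextSize promiscuous j)),
    ← lintegral_mul_const _ (h.measurable_process_cast N n)]
  refine lintegral_mono fun ω => ?_
  rw [ENNReal.ofReal_add (div_nonneg (p n).p00_nonneg (p n).p1Plus_nonneg)
    (div_nonneg (p n).p01_nonneg (p n).p1Plus_nonneg), mul_add,
    ← h.lintegral_sum_matedFemales, ← h.lintegral_sum_brotherlessFemales,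
    ← lintegral_add_left]
  · refine lintegral_mono fun ω' => ?_
    rw [← Nat.cast_add]
    exact Nat.cast_le.2 (nextSize_le _ _)
  · have : Measurable (fun v : ℕ → ℕ × ℕ =>
        ∑ i ∈ Finset.range (process promiscuous N ξ η n ω), matedFemales (v i)) :=
      Finset.measurable_fun_sum _ fun i _ => measurable_matedFemales.comp (measurable_pi_apply i)
    exact measurable_from_nat.comp (this.comp (measurable_offspring (h.measurable_pair n)))

lemma le_lintegral_process_succ (h : IsBivGeomArray P p ξ η) (N n : ℕ) :
    (∫⁻ ω, (process promiscuous N ξ η n ω : ENNReal) ∂P)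
        * ENNReal.ofReal ((p n).p00 / (p n).p1Plus)
      ≤ ∫⁻ ω, (process promiscuous N ξ η (n + 1) ω : ENNReal) ∂P := by
  simp_rw [process_succ]
  rw [h.lintegral_process_offspring promiscuous N n
    (F := fun j v => (nextSize promiscuous j v : ENNReal))
    (fun j => measurable_from_nat.comp (measurable_nextSize promiscuous j)),
    ← lintegral_mul_const _ (h.measurable_process_cast N n)]
  refine lintegral_mono fun ω => ?_
  rw [← h.lintegral_sum_matedFemales]
  exact lintegral_mono fun ω' => Nat.cast_le.2 (sum_matedFemales_le_nextSize _ _)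

/-- The terms with `t` bound the random fluctuation; the term with `p01` bounds the bias from
females without brothers. The parameter `t` is left free for balancing. -/
lemma lintegral_abs_process_succ_sub_le (h : IsBivGeomArray P p ξ η) (N n : ℕ) {t : ℝ}
    (ht : 0 < t) :
    ∫⁻ ω, ENNReal.ofReal |(process promiscuous N ξ η (n + 1) ω : ℝ)
        - (p n).p00 / (p n).p1Plus * process promiscuous N ξ η n ω| ∂P
      ≤ (∫⁻ ω, (process promiscuous N ξ η n ω : ENNReal) ∂P)
          * (ENNReal.ofReal (t / (p n).p1Plus ^ 2) + ENNReal.ofReal ((p n).p01 / (p n).p1Plus))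
        + ENNReal.ofReal (1 / (2 * t)) := by
  have hcast : Measurable (fun k : ℕ => (k : ℝ)) := measurable_from_nat
  simp_rw [process_succ]
  rw [h.lintegral_process_offspring promiscuous N n
    (F := fun j v => ENNReal.ofReal |(nextSize promiscuous j v : ℝ)
        - (p n).p00 / (p n).p1Plus * j|)
    (fun j => ENNReal.measurable_ofReal.comp
      ((hcast.comp (measurable_nextSize promiscuous j)).sub_const _).abs),
    ← lintegral_mul_const _ (h.measurable_process_cast N n)]
  have h1 : ENNReal.ofReal (1 / (2 * t)) = ∫⁻ _, ENNReal.ofReal (1 / (2 * t)) ∂P := by simp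
  rw [h1, ← lintegral_add_right _ measurable_const]
  refine lintegral_mono fun ω => ?_
  set j := process promiscuous N ξ η n ω
  calc _ ≤ ∫⁻ ω', (ENNReal.ofReal |(∑ i ∈ Finset.range j,
            (matedFemales (offspring ξ η n ω' i) : ℝ)) - (p n).p00 / (p n).p1Plus * j|
          + ((∑ i ∈ Finset.range j, brotherlessFemales (offspring ξ η n ω' i) : ℕ) : ENNReal))
          ∂P := by
        refine lintegral_mono fun ω' => ?_
        rw [← ENNReal.ofReal_natCast, ← ENNReal.ofReal_add (abs_nonneg _) (Nat.cast_nonneg _)]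
        exact ENNReal.ofReal_le_ofReal (abs_nextSize_sub_le _ _ _)
    _ = _ := lintegral_add_right _ (by
        have : Measurable (fun v : ℕ → ℕ × ℕ =>
            ∑ i ∈ Finset.range j, brotherlessFemales (v i)) :=
          Finset.measurable_fun_sum _ fun i _ =>
            measurable_brotherlessFemales.comp (measurable_pi_apply i)
        exact measurable_from_nat.comp (this.comp (measurable_offspring (h.measurable_pair n))))
    _ ≤ (j * ENNReal.ofReal (t / (p n).p1Plus ^ 2) + ENNReal.ofReal (1 / (2 * t)))
          + j * ENNReal.ofReal ((p n).p01 / (p n).p1Plus) := by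
        rw [h.lintegral_sum_brotherlessFemales]
        gcongr
        exact h.lintegral_abs_sum_matedFemales_sub_le n j ht
    _ = _ := by ring

lemma le_lintegral_process (h : IsBivGeomArray P p ξ η) (N n : ℕ) :
    N * ENNReal.ofReal (meanGrowth P promiscuous ξ η n)
      ≤ ∫⁻ ω, (process promiscuous N ξ η n ω : ENNReal) ∂P := by
  induction n with
  | zero => simp [meanGrowth, process]
  | succ n ih =>
    refine le_trans ?_ (h.le_lintegral_process_succ N n)
    rw [h.meanGrowth_succ, ENNReal.ofReal_mul', ← mul_assoc]
    · gcongr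
    · exact div_nonneg (p n).p00_nonneg (p n).p1Plus_nonneg

/-- In each generation the upper mean exceeds the rate `p00 / p1Plus` by the factor `1 + p01 / p00`.
-/
lemma lintegral_process_le_prod (h : IsBivGeomArray P p ξ η) (h00 : ∀ n, 0 < (p n).p00)
    (N n : ℕ) :
    ∫⁻ ω, (process promiscuous N ξ η n ω : ENNReal) ∂P
      ≤ N * ENNReal.ofReal (meanGrowth P promiscuous ξ η n
        * ∏ i ∈ Finset.range n, (1 + (p i).p01 / (p i).p00)) := by
  induction n with
  | zero => simp [meanGrowth, process]
  | succ n ih =>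
    refine (h.lintegral_process_succ_le N n).trans ?_
    have h1 := h00 n
    have h2 := (h.hasBivGeomLaw n 0).p1Plus_pos
    have h3 := (p n).p01_nonneg
    have e : meanGrowth P promiscuous ξ η (n + 1)
        * ∏ i ∈ Finset.range (n + 1), (1 + (p i).p01 / (p i).p00)
        = (meanGrowth P promiscuous ξ η n * ∏ i ∈ Finset.range n, (1 + (p i).p01 / (p i).p00))
          * ((p n).p00 / (p n).p1Plus + (p n).p01 / (p n).p1Plus) := by
      rw [h.meanGrowth_succ, Finset.prod_range_succ]
      field_simp
    rw [e, ENNReal.ofReal_mul' (by positivity), ← mul_assoc]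
    gcongr

lemma meanGrowth_pos (h : IsBivGeomArray P p ξ η) (h00 : ∀ n, 0 < (p n).p00) (n : ℕ) :
    0 < meanGrowth P promiscuous ξ η n := by
  induction n with
  | zero => simp [meanGrowth]
  | succ n ih =>
    rw [h.meanGrowth_succ]
    exact mul_pos ih (div_pos (h00 n) (h.hasBivGeomLaw n 0).p1Plus_pos)

/-- A zero of `p00` would make `μ` vanish from the next generation on. -/
lemma p00_pos (h : IsBivGeomArray P p ξ η)
    (hμ : Tendsto (meanGrowth P promiscuous ξ η) atTop atTop) (n : ℕ) : 0 < (p n).p00 := by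
  refine lt_of_le_of_ne (p n).p00_nonneg fun h0 => ?_
  have hz : ∀ m, meanGrowth P promiscuous ξ η (n + 1 + m) = 0 := by
    intro m
    induction m with
    | zero => rw [Nat.add_zero, h.meanGrowth_succ, ← h0]; simp
    | succ m ih => rw [← Nat.add_assoc, h.meanGrowth_succ, ih, zero_mul]
  obtain ⟨m, hm⟩ := (hμ.eventually_gt_atTop 0).exists_forall_of_atTop
  have := hm (n + 1 + m) (by omega)
  rw [hz] at this
  exact lt_irrefl _ this

lemma lintegral_process_le (h : IsBivGeomArray P p ξ η) (h00 : ∀ n, 0 < (p n).p00)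
    (hs : Summable fun n => (p n).p01 / (p n).p00) (N n : ℕ) :
    ∫⁻ ω, (process promiscuous N ξ η n ω : ENNReal) ∂P
      ≤ ENNReal.ofReal (N * Real.exp (∑' n, (p n).p01 / (p n).p00)
        * meanGrowth P promiscuous ξ η n) := by
  refine (h.lintegral_process_le_prod h00 N n).trans ?_
  rw [← ENNReal.ofReal_natCast, ← ENNReal.ofReal_mul (Nat.cast_nonneg _), mul_assoc,
    mul_comm (Real.exp _)]
  have hnn : ∀ i, 0 ≤ (p i).p01 / (p i).p00 := fun i =>
    div_nonneg (p i).p01_nonneg (p i).p00_nonneg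
  have hle : ∏ i ∈ Finset.range n, (1 + (p i).p01 / (p i).p00)
      ≤ Real.exp (∑' n, (p n).p01 / (p n).p00) := by
    calc _ ≤ ∏ i ∈ Finset.range n, Real.exp ((p i).p01 / (p i).p00) :=
          Finset.prod_le_prod (fun i _ => by linarith [hnn i]) fun i _ => by
            linarith [Real.add_one_le_exp ((p i).p01 / (p i).p00)]
      _ = Real.exp (∑ i ∈ Finset.range n, (p i).p01 / (p i).p00) := (Real.exp_sum _ _).symm
      _ ≤ _ := Real.exp_le_exp.2 (hs.sum_le_tsum _ fun i _ => hnn i)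
  have := h.meanGrowth_pos h00 n
  refine ENNReal.ofReal_le_ofReal ?_
  gcongr

/-- The increments of `Z n / μ n` in `L¹`. -/
lemma lintegral_abs_div_meanGrowth_sub_le (h : IsBivGeomArray P p ξ η)
    (h00 : ∀ n, 0 < (p n).p00) {N n : ℕ} {K : ℝ} (hK : 0 ≤ K)
    (hZ : ∫⁻ ω, (process promiscuous N ξ η n ω : ENNReal) ∂P
      ≤ ENNReal.ofReal (K * meanGrowth P promiscuous ξ η n)) :
    ∫⁻ ω, ENNReal.ofReal |(process promiscuous N ξ η (n + 1) ω : ℝ)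
          / meanGrowth P promiscuous ξ η (n + 1)
        - (process promiscuous N ξ η n ω : ℝ) / meanGrowth P promiscuous ξ η n| ∂P
      ≤ ENNReal.ofReal (((K + 1 / 2) * (√(meanGrowth P promiscuous ξ η n))⁻¹ + K * (p n).p01)
        / (p n).p00) := by
  have hμ := h.meanGrowth_pos h00 n
  have hμ' := h.meanGrowth_pos h00 (n + 1)
  have h1 := h00 n
  have h2 := (h.hasBivGeomLaw n 0).p1Plus_pos
  have h3 := (p n).p01_nonneg
  have hsucc := h.meanGrowth_succ n
  set m := meanGrowth P promiscuous ξ η n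
  set m' := meanGrowth P promiscuous ξ η (n + 1)
  have hsq : 0 < √m := Real.sqrt_pos.2 hμ
  have hss : √m ^ 2 = m := Real.sq_sqrt hμ.le
  -- This choice of `t` gives both fluctuation terms the order `√m / p1Plus`; division by `m' = m *
  -- p00 / p1Plus` leaves `1 / (√m * p00)`.
  have ht : 0 < (p n).p1Plus / √m := div_pos h2 hsq
  have key := h.lintegral_abs_process_succ_sub_le N n ht
  calc _ = ∫⁻ ω, ENNReal.ofReal (1 / m') * ENNReal.ofReal
          |(process promiscuous N ξ η (n + 1) ω : ℝ)
            - (p n).p00 / (p n).p1Plus * process promiscuous N ξ η n ω| ∂P := by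
        refine lintegral_congr fun ω => ?_
        nth_rewrite 1 [← abs_of_pos (by positivity : 0 < 1 / m')]
        rw [← ENNReal.ofReal_mul (abs_nonneg _), ← abs_mul]
        congr 2
        rw [hsucc]
        field_simp
    _ = ENNReal.ofReal (1 / m') * ∫⁻ ω, ENNReal.ofReal
          |(process promiscuous N ξ η (n + 1) ω : ℝ)
            - (p n).p00 / (p n).p1Plus * process promiscuous N ξ η n ω| ∂P :=
        lintegral_const_mul' _ _ ENNReal.ofReal_ne_top
    _ ≤ ENNReal.ofReal (1 / m') * (ENNReal.ofReal (K * m)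
          * (ENNReal.ofReal ((p n).p1Plus / √m / (p n).p1Plus ^ 2)
            + ENNReal.ofReal ((p n).p01 / (p n).p1Plus))
          + ENNReal.ofReal (1 / (2 * ((p n).p1Plus / √m)))) := by
        gcongr
        exact key.trans (by gcongr)
    _ = _ := by
        rw [← ENNReal.ofReal_add (by positivity) (by positivity),
          ← ENNReal.ofReal_mul (by positivity), ← ENNReal.ofReal_add (by positivity)
            (by positivity), ← ENNReal.ofReal_mul (by positivity)]
        congr 1
        rw [hsucc]
        clear key
        -- With `m = s²` the identity becomes one of rational functions.
        generalize √m = s at hsq hss ⊢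
        rw [← hss]
        field_simp
        ring

end IsBivGeomArray

omit [IsProbabilityMeasure P] in
/-- Nonnegative random variables whose increments have summable first absolute moments converge
almost surely and in mean. -/
lemma exists_limit_of_summable_increments {X : ℕ → Ω → ℝ} (hX : ∀ n, Measurable (X n))
    (hnn : ∀ n ω, 0 ≤ X n ω) (h0 : Integrable (X 0) P) {a : ℕ → ℝ} (ha : Summable a)
    (ha0 : ∀ n, 0 ≤ a n)
    (hinc : ∀ n, ∫⁻ ω, ENNReal.ofReal |X (n + 1) ω - X n ω| ∂P ≤ ENNReal.ofReal (a n)) :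
    ∃ W : Ω → ℝ, Measurable W ∧ (∀ ω, 0 ≤ W ω) ∧ Integrable W P ∧
      (∀ᵐ ω ∂P, Tendsto (fun n => X n ω) atTop (𝓝 (W ω))) ∧
      Tendsto (fun n => ∫ ω, X n ω ∂P) atTop (𝓝 (∫ ω, W ω ∂P)) := by
  -- The total variation of the path. It has finite mean, so paths are almost surely Cauchy, and `X
  -- 0 + D` dominates every `X n`.
  set D : Ω → ENNReal := fun ω => ∑' n, ENNReal.ofReal |X (n + 1) ω - X n ω| with hD
  have hdm : ∀ n, Measurable fun ω => ENNReal.ofReal |X (n + 1) ω - X n ω| := fun n =>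
    ENNReal.measurable_ofReal.comp ((hX (n + 1)).sub (hX n)).abs
  have hDm : Measurable D := Measurable.tsum hdm
  have hDint : ∫⁻ ω, D ω ∂P ≠ ⊤ := by
    rw [lintegral_tsum fun n => (hdm n).aemeasurable]
    refine ne_top_of_le_ne_top ?_ (ENNReal.tsum_le_tsum hinc)
    rw [← ENNReal.ofReal_tsum_of_nonneg ha0 ha]
    exact ENNReal.ofReal_ne_top
  have hfin : ∀ᵐ ω ∂P, D ω < ⊤ := ae_lt_top hDm hDint
  have hsum : ∀ᵐ ω ∂P, ∃ l, Tendsto (fun n => X n ω) atTop (𝓝 l) := by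
    filter_upwards [hfin] with ω hω
    refine cauchySeq_tendsto_of_complete (cauchySeq_of_summable_dist ?_)
    refine (ENNReal.summable_toReal hω.ne).congr fun n => ?_
    rw [ENNReal.toReal_ofReal (abs_nonneg _), Real.dist_eq, abs_sub_comm]
  obtain ⟨V, hVm, hV⟩ := measurable_limit_of_tendsto_metrizable_ae
    (fun n => (hX n).aemeasurable) hsum
  -- `V` may be negative on a null set; the maximum with 0 makes the limit nonnegative everywhere.
  have hW : ∀ᵐ ω ∂P, Tendsto (fun n => X n ω) atTop (𝓝 (max (V ω) 0)) := by
    filter_upwards [hV] with ω hω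
    refine (hω.max tendsto_const_nhds).congr fun n => max_eq_left (hnn n ω)
  have hgi : Integrable (fun ω => X 0 ω + (D ω).toReal) P :=
    h0.add (integrable_toReal_of_lintegral_ne_top hDm.aemeasurable hDint)
  have hdom : ∀ n, ∀ᵐ ω ∂P, ‖X n ω‖ ≤ X 0 ω + (D ω).toReal := by
    intro n
    filter_upwards [hfin] with ω hω
    rw [Real.norm_of_nonneg (hnn n ω)]
    have h1 : X n ω ≤ X 0 ω + ∑ i ∈ Finset.range n, |X (i + 1) ω - X i ω| := by
      induction n with
      | zero => simp
      | succ n ih =>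
        rw [Finset.sum_range_succ]
        linarith [le_abs_self (X (n + 1) ω - X n ω)]
    have h2 : ∑ i ∈ Finset.range n, |X (i + 1) ω - X i ω| ≤ (D ω).toReal := by
      rw [hD, ENNReal.tsum_toReal_eq fun _ => ENNReal.ofReal_ne_top]
      simp_rw [ENNReal.toReal_ofReal (abs_nonneg _)]
      refine Summable.sum_le_tsum _ (fun i _ => abs_nonneg _) ?_
      refine (ENNReal.summable_toReal hω.ne).congr fun n => ?_
      rw [ENNReal.toReal_ofReal (abs_nonneg _)]
    linarith
  have hWm : Measurable fun ω => max (V ω) 0 := hVm.max measurable_const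
  refine ⟨fun ω => max (V ω) 0, hWm, fun ω => le_max_right _ _, ?_, hW, ?_⟩
  · refine hgi.mono' hWm.aestronglyMeasurable ?_
    filter_upwards [hW, ae_all_iff.2 hdom] with ω h1 h2
    exact le_of_tendsto h1.norm (Eventually.of_forall h2)
  · exact tendsto_integral_of_dominated_convergence _ (fun n => (hX n).aestronglyMeasurable) hgi
      hdom hW

end BisexualBranching

/-! ### Consequences of the logarithmic scaling; the limit `W`. -/

namespace BisexualBranching

lemma tendsto_zero_of_tendsto_mul_atTop {f g : ℕ → ℝ} {L : ℝ} (hg : Tendsto g atTop atTop)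
    (h : Tendsto (fun n => f n * g n) atTop (𝓝 L)) : Tendsto f atTop (𝓝 0) := by
  refine (h.div_atTop hg).congr' ?_
  filter_upwards [hg.eventually_gt_atTop 0] with n hn
  field_simp

/-- The asymptotic assumptions on the offspring laws, where `ℓ n` stands for `log μ_n`. -/
structure LogScaling (p : ℕ → BernoulliPair) (ℓ : ℕ → ℝ) (a b c : ℝ) : Prop where
  tendsto_log : Tendsto ℓ atTop atTop
  p11_pos : ∀ᶠ n in atTop, 0 < (p n).p11
  lim_p11 : Tendsto (fun n => (p n).p11 * ℓ n) atTop (𝓝 (2 * c))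
  lim_p10 : Tendsto (fun n => (p n).p10 / (p n).p11 * ℓ n) atTop (𝓝 a)
  lim_p01 : Tendsto (fun n => (p n).p01 / (p n).p11 * ℓ n) atTop (𝓝 b)

namespace LogScaling

variable {p : ℕ → BernoulliPair} {ℓ : ℕ → ℝ} {a b c : ℝ}

lemma tendsto_p11 (h : LogScaling p ℓ a b c) : Tendsto (fun n => (p n).p11) atTop (𝓝 0) :=
  tendsto_zero_of_tendsto_mul_atTop h.tendsto_log h.lim_p11

lemma tendsto_p10 (h : LogScaling p ℓ a b c) : Tendsto (fun n => (p n).p10) atTop (𝓝 0) := by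
  have h1 := (tendsto_zero_of_tendsto_mul_atTop h.tendsto_log h.lim_p10).mul h.tendsto_p11
  rw [mul_zero] at h1
  refine h1.congr' ?_
  filter_upwards [h.p11_pos] with n hn
  field_simp

lemma tendsto_p01 (h : LogScaling p ℓ a b c) : Tendsto (fun n => (p n).p01) atTop (𝓝 0) := by
  have h1 := (tendsto_zero_of_tendsto_mul_atTop h.tendsto_log h.lim_p01).mul h.tendsto_p11
  rw [mul_zero] at h1
  refine h1.congr' ?_
  filter_upwards [h.p11_pos] with n hn
  field_simp

lemma tendsto_p1Plus (h : LogScaling p ℓ a b c) :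
    Tendsto (fun n => (p n).p1Plus) atTop (𝓝 0) := by
  simpa [BernoulliPair.p1Plus] using h.tendsto_p10.add h.tendsto_p11

lemma tendsto_pPlus1 (h : LogScaling p ℓ a b c) :
    Tendsto (fun n => (p n).pPlus1) atTop (𝓝 0) := by
  simpa [BernoulliPair.pPlus1] using h.tendsto_p01.add h.tendsto_p11

lemma tendsto_p0Plus (h : LogScaling p ℓ a b c) :
    Tendsto (fun n => (p n).p0Plus) atTop (𝓝 1) := by
  have h1 := h.tendsto_p1Plus.const_sub 1
  rw [sub_zero] at h1
  exact h1.congr fun n => by linarith [(p n).p0Plus_add_p1Plus]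

lemma tendsto_pPlus0 (h : LogScaling p ℓ a b c) :
    Tendsto (fun n => (p n).pPlus0) atTop (𝓝 1) := by
  have h1 := h.tendsto_pPlus1.const_sub 1
  rw [sub_zero] at h1
  exact h1.congr fun n => by linarith [(p n).pPlus0_add_pPlus1]

lemma tendsto_p00 (h : LogScaling p ℓ a b c) : Tendsto (fun n => (p n).p00) atTop (𝓝 1) := by
  have h1 := h.tendsto_p0Plus.sub h.tendsto_p01
  rw [sub_zero] at h1
  exact h1.congr fun n => by simp [BernoulliPair.p0Plus]

end LogScaling

variable {Ω : Type*} [MeasurableSpace Ω] {P : Measure Ω} [IsProbabilityMeasure P]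
  {p : ℕ → BernoulliPair} {ξ η : ℕ → ℕ → Ω → ℕ} {ℓ : ℕ → ℝ} {a b c : ℝ}

namespace IsBivGeomArray

/-- Ratio test: successive terms have ratio `√(p1Plus / p00)`, which tends to 0. -/
lemma summable_inv_sqrt_meanGrowth (h : IsBivGeomArray P p ξ η) (hs : LogScaling p ℓ a b c)
    (h00 : ∀ n, 0 < (p n).p00) :
    Summable fun n => (√(meanGrowth P promiscuous ξ η n))⁻¹ := by
  refine summable_of_ratio_test_tendsto_lt_one (l := 0) one_pos
    (Eventually.of_forall fun n => ?_) ?_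
  · exact inv_ne_zero (Real.sqrt_pos.2 (h.meanGrowth_pos h00 n)).ne'
  · have h1 : Tendsto (fun n => √((p n).p1Plus / (p n).p00)) atTop (𝓝 0) := by
      have := (hs.tendsto_p1Plus.div hs.tendsto_p00 one_ne_zero).sqrt
      simpa using this
    refine h1.congr fun n => ?_
    have h2 := Real.sqrt_pos.2 (h.meanGrowth_pos h00 n)
    have h3 := Real.sqrt_pos.2 (h00 n)
    have h4 := Real.sqrt_pos.2 (h.hasBivGeomLaw n 0).p1Plus_pos
    rw [Real.norm_of_nonneg (by positivity), Real.norm_of_nonneg (by positivity),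
      h.meanGrowth_succ, Real.sqrt_mul (h.meanGrowth_pos h00 n).le,
      Real.sqrt_div' _ (h00 n).le, Real.sqrt_div' _ (h.hasBivGeomLaw n 0).p1Plus_pos.le]
    field_simp

/-- Almost sure and mean convergence of the normalized process to a nondegenerate limit. -/
lemma exists_limit (h : IsBivGeomArray P p ξ η) (hs : LogScaling p ℓ a b c)
    (hμ : Tendsto (meanGrowth P promiscuous ξ η) atTop atTop)
    (hsum : Summable fun n => (p n).pPlus1) {N : ℕ} (hN : 0 < N) :
    ∃ W : Ω → ℝ, Measurable W ∧ (∀ ω, 0 ≤ W ω) ∧ Integrable W P ∧ 0 < P {ω | 0 < W ω} ∧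
      ∀ᵐ ω ∂P, Tendsto (fun n => (process promiscuous N ξ η n ω : ℝ)
        / meanGrowth P promiscuous ξ η n) atTop (𝓝 (W ω)) := by
  have h00 := h.p00_pos hμ
  have hp01 : Summable fun n => (p n).p01 :=
    hsum.of_nonneg_of_le (fun n => (p n).p01_nonneg) fun n => by
      have := (p n).p11_nonneg
      unfold BernoulliPair.pPlus1
      linarith
  -- Eventually `1 / p00 < 2`, so division by `p00` preserves summability.
  have hhalf : ∀ᶠ n in atTop, 1 / 2 < (p n).p00 := hs.tendsto_p00.eventually_const_lt (by norm_num)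
  have hdiv : ∀ u : ℕ → ℝ, Summable u → (∀ n, 0 ≤ u n) → Summable fun n => u n / (p n).p00 := by
    intro u hu hu0
    refine Summable.of_norm_bounded_eventually_nat (hu.mul_left 2) ?_
    filter_upwards [hhalf] with n hn
    rw [Real.norm_of_nonneg (div_nonneg (hu0 n) (h00 n).le), div_le_iff₀ (h00 n)]
    nlinarith [hu0 n]
  have hδ := hdiv _ hp01 fun n => (p n).p01_nonneg
  set K : ℝ := N * Real.exp (∑' n, (p n).p01 / (p n).p00)
  have hK : 0 ≤ K := by positivity
  have hcast : Measurable (fun k : ℕ => (k : ℝ)) := measurable_from_nat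
  have hXm : ∀ n, Measurable fun ω => (process promiscuous N ξ η n ω : ℝ)
      / meanGrowth P promiscuous ξ η n := fun n =>
    (hcast.comp (h.measurable_process promiscuous N n)).div_const _
  have ha0 : ∀ n, 0 ≤ (K + 1 / 2) * (√(meanGrowth P promiscuous ξ η n))⁻¹ + K * (p n).p01 := by
    intro n
    have := (p n).p01_nonneg
    positivity
  obtain ⟨W, hWm, hW0, hWi, hWt, hWE⟩ := exists_limit_of_summable_increments (P := P) hXm
    (fun n ω => div_nonneg (Nat.cast_nonneg _) (h.meanGrowth_pos h00 n).le)
    (by simp [process])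
    (hdiv _ (((h.summable_inv_sqrt_meanGrowth hs h00).mul_left (K + 1 / 2)).add (hp01.mul_left K))
      ha0)
    (fun n => div_nonneg (ha0 n) (h00 n).le)
    (fun n => h.lintegral_abs_div_meanGrowth_sub_le h00 hK (h.lintegral_process_le h00 hδ N n))
  refine ⟨W, hWm, hW0, hWi, ?_, hWt⟩
  -- Convergence in mean carries this lower bound over to `W`, which therefore cannot vanish almost
  -- surely.
  have hEn : ∀ n, (N : ℝ) ≤ ∫ ω, (process promiscuous N ξ η n ω : ℝ)
      / meanGrowth P promiscuous ξ η n ∂P := by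
    intro n
    have hm := h.meanGrowth_pos h00 n
    rw [integral_div, le_div_iff₀ hm, integral_eq_lintegral_of_nonneg_ae
      (ae_of_all _ fun ω => Nat.cast_nonneg _)
      (hcast.comp (h.measurable_process promiscuous N n)).aestronglyMeasurable]
    simp_rw [ENNReal.ofReal_natCast]
    have h1 := ENNReal.toReal_mono (ne_top_of_le_ne_top ENNReal.ofReal_ne_top
      (h.lintegral_process_le h00 hδ N n)) (h.le_lintegral_process N n)
    rwa [ENNReal.toReal_mul, ENNReal.toReal_natCast, ENNReal.toReal_ofReal hm.le] at h1
  have hEW : (N : ℝ) ≤ ∫ ω, W ω ∂P := ge_of_tendsto' hWE hEn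
  rw [pos_iff_ne_zero]
  intro h0
  have hz : W =ᵐ[P] 0 := by
    have : ∀ᵐ ω ∂P, ¬ 0 < W ω := by rw [ae_iff]; simpa using h0
    filter_upwards [this] with ω hω
    exact le_antisymm (not_lt.1 hω) (hW0 ω)
  rw [integral_eq_zero_of_ae hz] at hEW
  have : (0 : ℝ) < N := by exact_mod_cast hN
  linarith

end IsBivGeomArray

end BisexualBranching

/-! ### Asymptotics of geometric tails at the extreme levels. -/

namespace BisexualBranching

/-- `(1 - e_n) ^ m_n → exp (-α)` if `e_n → 0` and `m_n e_n → α`. -/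
lemma tendsto_one_sub_pow_exp {e : ℕ → ℝ} {m : ℕ → ℕ} {α : ℝ} (he : Tendsto e atTop (𝓝 0))
    (hme : Tendsto (fun n => (m n : ℝ) * e n) atTop (𝓝 α)) :
    Tendsto (fun n => (1 - e n) ^ m n) atTop (𝓝 (Real.exp (-α))) := by
  have hlt : ∀ᶠ n in atTop, |e n| < 1 := by
    have := he.abs
    rw [abs_zero] at this
    exact this.eventually_lt_const one_pos
  -- The Taylor bound `|e + log (1 - e)| ≤ e² / (1 - |e|)` splits off one factor `m e`, which stays
  -- bounded.
  have hrem : Tendsto (fun n => (m n : ℝ) * (e n + Real.log (1 - e n))) atTop (𝓝 0) := by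
    have hb : Tendsto (fun n => |(m n : ℝ) * e n| * (|e n| / (1 - |e n|))) atTop (𝓝 0) := by
      have h1 : Tendsto (fun n => |e n| / (1 - |e n|)) atTop (𝓝 (|0| / (1 - |0|))) :=
        he.abs.div (he.abs.const_sub 1) (by simp)
      simpa using hme.abs.mul h1
    refine squeeze_zero_norm' ?_ hb
    filter_upwards [hlt] with n hn
    have h1 := Real.abs_log_sub_add_sum_range_le hn 1
    simp only [Finset.sum_range_one, Nat.cast_zero, zero_add, pow_one, div_one] at h1
    rw [Real.norm_eq_abs, abs_mul, abs_mul, mul_assoc]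
    refine mul_le_mul_of_nonneg_left (h1.trans (le_of_eq ?_)) (abs_nonneg _)
    ring
  have hlog : Tendsto (fun n => (m n : ℝ) * Real.log (1 - e n)) atTop (𝓝 (-α)) := by
    have := hrem.sub hme
    rw [zero_sub] at this
    exact this.congr fun n => by ring
  refine ((Real.continuous_exp.tendsto _).comp hlog).congr' ?_
  filter_upwards [hlt] with n hn
  have : 0 < 1 - e n := by linarith [le_abs_self (e n)]
  rw [Function.comp_apply, ← Real.log_pow, Real.exp_log (pow_pos this _)]

/-- Second order asymptotics of a geometric tail at a level `m` with `s m = ℓ + x + o(1)`. -/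
lemma tendsto_exp_mul_one_sub_pow {ℓ s d : ℕ → ℝ} {m : ℕ → ℕ} {x a c : ℝ}
    (hℓ : Tendsto ℓ atTop atTop) (hs : ∀ᶠ n in atTop, 0 < s n)
    (hc : Tendsto (fun n => s n * ℓ n) atTop (𝓝 (2 * c)))
    (ha : Tendsto (fun n => d n / s n * ℓ n) atTop (𝓝 a))
    (hm : Tendsto (fun n => s n * m n - ℓ n) atTop (𝓝 x)) :
    Tendsto (fun n => Real.exp (ℓ n) * (1 - (s n + d n)) ^ m n) atTop
      (𝓝 (Real.exp (-x - a - c))) := by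
  have hs0 : Tendsto s atTop (𝓝 0) := tendsto_zero_of_tendsto_mul_atTop hℓ hc
  have hr0 : Tendsto (fun n => d n / s n) atTop (𝓝 0) := tendsto_zero_of_tendsto_mul_atTop hℓ ha
  have hr1 : Tendsto (fun n => 1 + d n / s n) atTop (𝓝 1) := by simpa using hr0.const_add 1
  have hq : Tendsto (fun n => s n + d n) atTop (𝓝 0) := by
    have := hs0.mul hr1
    rw [zero_mul] at this
    refine this.congr' ?_
    filter_upwards [hs] with n hn
    field_simp
  have hlt : ∀ᶠ n in atTop, |s n + d n| < 1 := by
    have := hq.abs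
    rw [abs_zero] at this
    exact this.eventually_lt_const one_pos
  -- Here `m (s + d) = s m (1 + d / s)` with `s m = ℓ + x + o(1)`, and `ℓ d / s → a`.
  have hfirst : Tendsto (fun n => ℓ n - m n * (s n + d n)) atTop (𝓝 (-x - a)) := by
    have := (hm.mul hr1).neg.sub ha
    rw [mul_one] at this
    refine this.congr' ?_
    filter_upwards [hs] with n hn
    field_simp
    ring
  -- Since `s² m` behaves like `s ℓ`, the quadratic term survives; half of its limit `2 c` is the
  -- `c` in the exponent.
  have hsecond : Tendsto (fun n => m n * (s n + d n) ^ 2) atTop (𝓝 (2 * c)) := by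
    have := ((hm.mul hs0).add hc).mul (hr1.pow 2)
    rw [mul_zero, zero_add, one_pow, mul_one] at this
    refine this.congr' ?_
    filter_upwards [hs] with n hn
    field_simp
    ring
  have hrem : Tendsto (fun n => (m n : ℝ) * ((s n + d n) + (s n + d n) ^ 2 / 2
      + Real.log (1 - (s n + d n)))) atTop (𝓝 0) := by
    have hb : Tendsto (fun n => |(m n : ℝ) * (s n + d n) ^ 2|
        * (|s n + d n| / (1 - |s n + d n|))) atTop (𝓝 0) := by
      have h1 : Tendsto (fun n => |s n + d n| / (1 - |s n + d n|)) atTop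
          (𝓝 (|0| / (1 - |0|))) := hq.abs.div (hq.abs.const_sub 1) (by simp)
      simpa using hsecond.abs.mul h1
    refine squeeze_zero_norm' ?_ hb
    filter_upwards [hlt] with n hn
    have h1 := Real.abs_log_sub_add_sum_range_le hn 2
    simp only [Finset.sum_range_succ, Finset.sum_range_zero, Nat.cast_zero, zero_add, pow_one,
      div_one, Nat.cast_one, one_add_one_eq_two] at h1
    rw [Real.norm_eq_abs, abs_mul, abs_mul, mul_assoc]
    refine mul_le_mul_of_nonneg_left (h1.trans (le_of_eq ?_)) (abs_nonneg _)
    rw [abs_pow]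
    ring
  have hlog : Tendsto (fun n => ℓ n + m n * Real.log (1 - (s n + d n))) atTop
      (𝓝 (-x - a - c)) := by
    have := (hrem.add hfirst).sub (hsecond.div_const 2)
    rw [zero_add, mul_div_cancel_left₀ c two_ne_zero] at this
    exact this.congr fun n => by ring
  refine ((Real.continuous_exp.tendsto _).comp hlog).congr' ?_
  filter_upwards [hlt] with n hn
  have : 0 < 1 - (s n + d n) := by linarith [le_abs_self (s n + d n)]
  rw [Function.comp_apply, Real.exp_add, ← Real.log_pow, Real.exp_log (pow_pos this _)]

/-- The integer level `⌊(x + ℓ) / s⌋ + 1`. -/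
lemma tendsto_mul_floor_add_one_sub {ℓ s : ℕ → ℝ} (hℓ : Tendsto ℓ atTop atTop)
    (hs : ∀ᶠ n in atTop, 0 < s n) (hs0 : Tendsto s atTop (𝓝 0)) (x : ℝ) :
    Tendsto (fun n => s n * ((⌊(x + ℓ n) / s n⌋₊ + 1 : ℕ) : ℝ) - ℓ n) atTop (𝓝 x) := by
  have hup : Tendsto (fun n => x + s n) atTop (𝓝 x) := by simpa using hs0.const_add x
  refine tendsto_of_tendsto_of_tendsto_of_le_of_le' tendsto_const_nhds hup ?_ ?_
  · filter_upwards [hs] with n hn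
    have h1 := Nat.lt_floor_add_one ((x + ℓ n) / s n)
    rw [div_lt_iff₀ hn] at h1
    push_cast
    linarith
  -- The natural floor of a negative number is 0, so the bound `floor ≤ argument` needs `x + ℓ ≥ 0`.
  · filter_upwards [hs, hℓ.eventually_ge_atTop (-x)] with n hn hl
    have h1 := Nat.floor_le (div_nonneg (by linarith : 0 ≤ x + ℓ n) hn.le)
    rw [le_div_iff₀ hn] at h1
    push_cast
    linarith

/-- The correction factor of the joint tail: for `d = p10`, `u = pPlus0` the base is `p00 / pPlus0`.
-/
lemma tendsto_one_sub_div_pow {ℓ s d u : ℕ → ℝ} {m : ℕ → ℕ} {x a : ℝ}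
    (hℓ : Tendsto ℓ atTop atTop) (hs : ∀ᶠ n in atTop, 0 < s n) (hd : Tendsto d atTop (𝓝 0))
    (ha : Tendsto (fun n => d n / s n * ℓ n) atTop (𝓝 a)) (hu : Tendsto u atTop (𝓝 1))
    (hm : Tendsto (fun n => s n * m n - ℓ n) atTop (𝓝 x)) :
    Tendsto (fun n => (1 - d n / u n) ^ m n) atTop (𝓝 (Real.exp (-a))) := by
  have h0 : Tendsto (fun n => d n / u n) atTop (𝓝 (0 / 1)) := hd.div hu one_ne_zero
  rw [zero_div] at h0
  refine tendsto_one_sub_pow_exp h0 ?_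
  have hr0 : Tendsto (fun n => d n / s n) atTop (𝓝 0) := tendsto_zero_of_tendsto_mul_atTop hℓ ha
  have := ((hm.mul hr0).add ha).div hu one_ne_zero
  rw [mul_zero, zero_add, div_one] at this
  refine this.congr' ?_
  filter_upwards [hs] with n hn
  rw [Pi.div_apply]
  field_simp
  ring

namespace LogScaling

variable {p : ℕ → BernoulliPair} {ℓ : ℕ → ℝ} {a b c x y : ℝ} {m k : ℕ → ℕ}

lemma tendsto_exp_mul_p0Plus_pow (h : LogScaling p ℓ a b c)
    (hm : Tendsto (fun n => (p n).p11 * m n - ℓ n) atTop (𝓝 x)) :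
    Tendsto (fun n => Real.exp (ℓ n) * (p n).p0Plus ^ m n) atTop
      (𝓝 (Real.exp (-x - a - c))) := by
  refine (tendsto_exp_mul_one_sub_pow h.tendsto_log h.p11_pos h.lim_p11 h.lim_p10 hm).congr
    fun n => ?_
  rw [show (p n).p0Plus = 1 - ((p n).p11 + (p n).p10) by
    unfold BernoulliPair.p0Plus; linarith [(p n).sum_eq_one]]

lemma tendsto_exp_mul_pPlus0_pow (h : LogScaling p ℓ a b c)
    (hm : Tendsto (fun n => (p n).p11 * m n - ℓ n) atTop (𝓝 x)) :
    Tendsto (fun n => Real.exp (ℓ n) * (p n).pPlus0 ^ m n) atTop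
      (𝓝 (Real.exp (-x - b - c))) := by
  refine (tendsto_exp_mul_one_sub_pow h.tendsto_log h.p11_pos h.lim_p11 h.lim_p01 hm).congr
    fun n => ?_
  rw [show (p n).pPlus0 = 1 - ((p n).p11 + (p n).p01) by
    unfold BernoulliPair.pPlus0; linarith [(p n).sum_eq_one]]

/-- For `m ≤ k` the survival function is `pPlus0 ^ k * (p00 / pPlus0) ^ m`: the marginal tail at the
larger level, times a factor tending to `exp (-a)`. -/
lemma tendsto_exp_mul_survival_of_le (h : LogScaling p ℓ a b c)
    (hm : Tendsto (fun n => (p n).p11 * m n - ℓ n) atTop (𝓝 x))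
    (hk : Tendsto (fun n => (p n).p11 * k n - ℓ n) atTop (𝓝 y))
    (hmk : ∀ᶠ n in atTop, m n ≤ k n) :
    Tendsto (fun n => Real.exp (ℓ n) * (p n).survival (m n) (k n)) atTop
      (𝓝 (Real.exp (-y - a - b - c))) := by
  have h1 := (h.tendsto_exp_mul_pPlus0_pow hk).mul (tendsto_one_sub_div_pow h.tendsto_log h.p11_pos
    h.tendsto_p10 h.lim_p10 h.tendsto_pPlus0 hm)
  rw [← Real.exp_add, show -y - b - c + -a = -y - a - b - c by ring] at h1
  refine h1.congr' ?_
  filter_upwards [hmk, h.tendsto_pPlus0.eventually_const_lt one_pos] with n hn hpos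
  rw [(p n).survival_of_le hn, show 1 - (p n).p10 / (p n).pPlus0 = (p n).p00 / (p n).pPlus0 by
    rw [eq_div_iff hpos.ne', sub_mul, div_mul_cancel₀ _ hpos.ne']
    unfold BernoulliPair.pPlus0; ring, div_pow, ← Nat.add_sub_cancel' hn, pow_add,
    Nat.add_sub_cancel_left]
  field_simp

lemma tendsto_exp_mul_survival_of_ge (h : LogScaling p ℓ a b c)
    (hm : Tendsto (fun n => (p n).p11 * m n - ℓ n) atTop (𝓝 x))
    (hk : Tendsto (fun n => (p n).p11 * k n - ℓ n) atTop (𝓝 y))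
    (hmk : ∀ᶠ n in atTop, k n ≤ m n) :
    Tendsto (fun n => Real.exp (ℓ n) * (p n).survival (m n) (k n)) atTop
      (𝓝 (Real.exp (-x - a - b - c))) := by
  have h1 := (h.tendsto_exp_mul_p0Plus_pow hm).mul (tendsto_one_sub_div_pow h.tendsto_log h.p11_pos
    h.tendsto_p01 h.lim_p01 h.tendsto_p0Plus hk)
  rw [← Real.exp_add, show -x - a - c + -b = -x - a - b - c by ring] at h1
  refine h1.congr' ?_
  filter_upwards [hmk, h.tendsto_p0Plus.eventually_const_lt one_pos] with n hn hpos
  rw [(p n).survival_of_ge hn, show 1 - (p n).p01 / (p n).p0Plus = (p n).p00 / (p n).p0Plus by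
    rw [eq_div_iff hpos.ne', sub_mul, div_mul_cancel₀ _ hpos.ne']
    unfold BernoulliPair.p0Plus; ring, div_pow, ← Nat.add_sub_cancel' hn, pow_add,
    Nat.add_sub_cancel_left]
  field_simp

/-- The level which `ξ` (or `η`) must not exceed for `p₁₁ ξ - ℓ ≤ x` to hold. -/
noncomputable def level (p : ℕ → BernoulliPair) (ℓ : ℕ → ℝ) (x : ℝ) (n : ℕ) : ℕ :=
  ⌊(x + ℓ n) / (p n).p11⌋₊

/-- The probability that one mating unit of generation `n` exceeds one of its two levels. -/
noncomputable def exceedance (p : ℕ → BernoulliPair) (ℓ : ℕ → ℝ) (x y : ℝ) (n : ℕ) : ℝ :=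
  (p n).p0Plus ^ (level p ℓ x n + 1) + (p n).pPlus0 ^ (level p ℓ y n + 1)
    - (p n).survival (level p ℓ x n + 1) (level p ℓ y n + 1)

lemma tendsto_exp_mul_exceedance (h : LogScaling p ℓ a b c) (x y : ℝ) :
    Tendsto (fun n => Real.exp (ℓ n) * exceedance p ℓ x y n) atTop
      (𝓝 (Real.exp (-x - a - c) + Real.exp (-y - b - c) - Real.exp (-max x y - a - b - c))) := by
  have hx := tendsto_mul_floor_add_one_sub h.tendsto_log h.p11_pos h.tendsto_p11 x
  have hy := tendsto_mul_floor_add_one_sub h.tendsto_log h.p11_pos h.tendsto_p11 y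
  -- The levels are ordered like `x` and `y` for every `n`, so one branch of the survival function
  -- applies throughout; hence `max x y` in the limit.
  have hmono : ∀ {x y : ℝ}, x ≤ y → ∀ n, level p ℓ x n + 1 ≤ level p ℓ y n + 1 := by
    intro x y hxy n
    have := (p n).p11_nonneg
    unfold level
    gcongr
  have hsurv : Tendsto (fun n => Real.exp (ℓ n)
      * (p n).survival (level p ℓ x n + 1) (level p ℓ y n + 1)) atTop
      (𝓝 (Real.exp (-max x y - a - b - c))) := by
    rcases le_total x y with hxy | hxy
    · rw [max_eq_right hxy]
      exact h.tendsto_exp_mul_survival_of_le hx hy (Eventually.of_forall (hmono hxy))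
    · rw [max_eq_left hxy]
      exact h.tendsto_exp_mul_survival_of_ge hx hy (Eventually.of_forall (hmono hxy))
  refine (((h.tendsto_exp_mul_p0Plus_pow hx).add (h.tendsto_exp_mul_pPlus0_pow hy)).sub
    hsurv).congr fun n => ?_
  unfold exceedance level
  ring

end LogScaling

/-! ### The offspring maxima and their limit law. -/

variable {Ω : Type*} [MeasurableSpace Ω] {P : Measure Ω} [IsProbabilityMeasure P]
  {p : ℕ → BernoulliPair} {ξ η : ℕ → ℕ → Ω → ℕ} {ℓ : ℕ → ℝ} {a b c : ℝ}

namespace IsBivGeomArray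

/-- The joint distribution function of the offspring maxima. -/
lemma measureReal_forall_le (h : IsBivGeomArray P p ξ η) (L : ℕ → ℕ → ℕ) (N n l k : ℕ) :
    P.real {ω | ∀ i < process L N ξ η n ω, ξ n i ω ≤ l ∧ η n i ω ≤ k}
      = ∫ ω, (1 - ((p n).p0Plus ^ (l + 1) + (p n).pPlus0 ^ (k + 1)
        - (p n).survival (l + 1) (k + 1))) ^ process L N ξ η n ω ∂P := by
  set H := 1 - ((p n).p0Plus ^ (l + 1) + (p n).pPlus0 ^ (k + 1)
        - (p n).survival (l + 1) (k + 1)) with hH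
  have hHeq : ∀ i, P.real {ω | ξ n i ω ≤ l ∧ η n i ω ≤ k} = H := fun i =>
    (h.hasBivGeomLaw n i).measureReal_le_le l k
  have hH0 : 0 ≤ H := hHeq 0 ▸ measureReal_nonneg
  set B : Set (ℕ × ℕ) := {q | q.1 ≤ l ∧ q.2 ≤ k}
  have hB : MeasurableSet B := B.to_countable.measurableSet
  have hset : ∀ j : ℕ, MeasurableSet {v : ℕ → ℕ × ℕ | ∀ i < j, v i ∈ B} := by
    intro j
    have : {v : ℕ → ℕ × ℕ | ∀ i < j, v i ∈ B} = ⋂ i, ⋂ (_ : i < j), (fun v => v i) ⁻¹' B := by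
      ext v
      simp
    rw [this]
    exact MeasurableSet.iInter fun i => MeasurableSet.iInter fun _ => measurable_pi_apply i hB
  -- For a fixed number `j` of units, the vectors are independent with a common law.
  have hprod : ∀ j : ℕ, P {ω | ∀ i < j, offspring ξ η n ω i ∈ B} = ENNReal.ofReal (H ^ j) := by
    intro j
    have h1 := (h.indepFun_row n).measure_inter_preimage_eq_mul (Finset.range j)
      (sets := fun _ => B) fun _ _ => hB
    have h2 : {ω | ∀ i < j, offspring ξ η n ω i ∈ B}
        = ⋂ i ∈ Finset.range j, (fun ω => (ξ n i ω, η n i ω)) ⁻¹' B := by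
      ext ω
      simp [offspring]
    have h3 : ∀ i, P ((fun ω => (ξ n i ω, η n i ω)) ⁻¹' B) = ENNReal.ofReal H := by
      intro i
      rw [← hHeq i, ofReal_measureReal]
      rfl
    rw [h2, h1, ENNReal.ofReal_pow hH0]
    simp [h3]
  have hZ := h.measurable_process L N n
  have hV : Measurable (offspring ξ η n) := measurable_offspring (h.measurable_pair n)
  have hE : MeasurableSet {ω | ∀ i < process L N ξ η n ω, ξ n i ω ≤ l ∧ η n i ω ≤ k} := by
    have : MeasurableSet {q : ℕ × (ℕ → ℕ × ℕ) | ∀ i < q.1, q.2 i ∈ B} := by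
      have h1 := measurable_of_measurable_fiber
        (F := fun j => Set.indicator {v : ℕ → ℕ × ℕ | ∀ i < j, v i ∈ B} fun _ => (1 : ℕ))
        fun j => measurable_const.indicator (hset j)
      convert h1 (measurableSet_singleton 1) using 1
      ext q
      by_cases hq : ∀ i < q.1, q.2 i ∈ B <;> simp [Set.indicator, hq]
    exact (hZ.prodMk hV) this
  have hlin : P {ω | ∀ i < process L N ξ η n ω, ξ n i ω ≤ l ∧ η n i ω ≤ k}
      = ∫⁻ ω, ENNReal.ofReal (H ^ process L N ξ η n ω) ∂P := by
    rw [← lintegral_indicator_one hE]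
    have h1 := h.lintegral_process_offspring L N n
      (F := fun j => Set.indicator {v : ℕ → ℕ × ℕ | ∀ i < j, v i ∈ B} 1)
      fun j => measurable_const.indicator (hset j)
    refine h1.trans (lintegral_congr fun ω => ?_)
    rw [← hprod, ← lintegral_indicator_one]
    · rfl
    · exact hV (hset _)
  have hmeas : Measurable fun ω => H ^ process L N ξ η n ω :=
    (measurable_from_nat (f := fun j => H ^ j)).comp hZ
  rw [measureReal_def, hlin, integral_eq_lintegral_of_nonneg_ae
    (ae_of_all _ fun ω => pow_nonneg hH0 _) hmeas.aestronglyMeasurable]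

/-- The conditions on `ℓ n` make the real thresholds nonnegative, so that they may be replaced by
their natural floors. The empty maximum 0 then satisfies the bounds, in accordance with the zeroth
power being 1. -/
lemma measureReal_offspringMax_le (h : IsBivGeomArray P p ξ η) (L : ℕ → ℕ → ℕ) (N : ℕ) {x y : ℝ}
    {n : ℕ} (hp : 0 < (p n).p11) (hx : -x ≤ ℓ n) (hy : -y ≤ ℓ n) :
    P.real {ω | (p n).p11 * (offspringMax (process L N ξ η) ξ n ω : ℝ) - ℓ n ≤ x ∧
        (p n).p11 * (offspringMax (process L N ξ η) η n ω : ℝ) - ℓ n ≤ y}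
      = ∫ ω, (1 - LogScaling.exceedance p ℓ x y n) ^ process L N ξ η n ω ∂P := by
  unfold LogScaling.exceedance
  rw [← h.measureReal_forall_le]
  congr 1
  have key : ∀ {x : ℝ} (_ : -x ≤ ℓ n) (m : ℕ),
      (p n).p11 * (m : ℝ) - ℓ n ≤ x ↔ m ≤ LogScaling.level p ℓ x n := by
    intro x hx m
    rw [LogScaling.level, Nat.le_floor_iff (div_nonneg (by linarith) hp.le), le_div_iff₀ hp]
    constructor <;> intro hh <;> linarith
  ext ω
  simp only [Set.mem_ofPred_eq, key hx, key hy, offspringMax, Finset.sup_le_iff, Finset.mem_range]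
  exact ⟨fun hh i hi => ⟨hh.1 i hi, hh.2 i hi⟩, fun hh => ⟨fun i hi => (hh i hi).1,
    fun i hi => (hh i hi).2⟩⟩

/-- Convergence of the joint distribution functions of the normalized offspring maxima. -/
lemma tendsto_measureReal_offspringMax_le (h : IsBivGeomArray P p ξ η) {μ : ℕ → ℝ}
    (hμ : Tendsto μ atTop atTop) (hs : LogScaling p (fun n => Real.log (μ n)) a b c)
    (L : ℕ → ℕ → ℕ) (N : ℕ) {W : Ω → ℝ} (hWm : Measurable W) (hW0 : ∀ ω, 0 ≤ W ω)
    (hW : ∀ᵐ ω ∂P, Tendsto (fun n => (process L N ξ η n ω : ℝ) / μ n) atTop (𝓝 (W ω)))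
    (x y : ℝ) :
    Tendsto (fun n => P.real {ω |
        (p n).p11 * (offspringMax (process L N ξ η) ξ n ω : ℝ) - Real.log (μ n) ≤ x ∧
        (p n).p11 * (offspringMax (process L N ξ η) η n ω : ℝ) - Real.log (μ n) ≤ y})
      atTop (𝓝 (∫ z in Set.Ici (0 : ℝ), limitG a b c x y ^ z ∂(P.map W))) := by
  set e := LogScaling.exceedance p (fun n => Real.log (μ n)) x y with he
  set lam := Real.exp (-x - a - c) + Real.exp (-y - b - c) - Real.exp (-max x y - a - b - c)
    with hlam
  have hG : limitG a b c x y = Real.exp (-lam) := by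
    rw [limitG, hlam]
    congr 1
    ring
  have hμe : Tendsto (fun n => μ n * e n) atTop (𝓝 lam) := by
    refine (hs.tendsto_exp_mul_exceedance x y).congr' ?_
    filter_upwards [hμ.eventually_gt_atTop 0] with n hn
    rw [Real.exp_log hn]
  have he0 : Tendsto e atTop (𝓝 0) :=
    tendsto_zero_of_tendsto_mul_atTop hμ (hμe.congr fun n => mul_comm _ _)
  have hint : ∫ z in Set.Ici (0 : ℝ), limitG a b c x y ^ z ∂(P.map W)
      = ∫ ω, Real.exp (-(W ω * lam)) ∂P := by
    have hpre : W ⁻¹' Set.Ici 0 = Set.univ := by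
      ext ω
      simpa using hW0 ω
    have hm : Measurable fun z : ℝ => limitG a b c x y ^ z := by fun_prop
    rw [setIntegral_map measurableSet_Ici hm.aestronglyMeasurable hWm.aemeasurable, hpre,
      Measure.restrict_univ]
    refine integral_congr_ae (ae_of_all _ fun ω => ?_)
    simp only [hG]
    rw [← Real.exp_mul]
    congr 1
    ring
  rw [hint]
  have hev : ∀ᶠ n in atTop, (∫ ω, (1 - e n) ^ process L N ξ η n ω ∂P) = P.real {ω |
        (p n).p11 * (offspringMax (process L N ξ η) ξ n ω : ℝ) - Real.log (μ n) ≤ x ∧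
        (p n).p11 * (offspringMax (process L N ξ η) η n ω : ℝ) - Real.log (μ n) ≤ y} := by
    filter_upwards [hs.p11_pos, hs.tendsto_log.eventually_ge_atTop (-x),
      hs.tendsto_log.eventually_ge_atTop (-y)] with n h1 h2 h3
    exact (h.measureReal_offspringMax_le (ℓ := fun n => Real.log (μ n)) L N h1 h2 h3).symm
  refine Tendsto.congr' hev ?_
  -- `1 - e n` is a probability, so all its powers are dominated by 1.
  have hrange : ∀ n, 0 ≤ 1 - e n ∧ 1 - e n ≤ 1 := by
    intro n
    have h1 := (h.hasBivGeomLaw n 0).measureReal_le_le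
      (LogScaling.level p (fun n => Real.log (μ n)) x n)
      (LogScaling.level p (fun n => Real.log (μ n)) y n)
    have h2 : 1 - e n = P.real _ := h1.symm
    rw [h2]
    exact ⟨measureReal_nonneg, measureReal_le_one⟩
  refine tendsto_integral_of_dominated_convergence (fun _ => 1) (fun n => ?_)
    (integrable_const _) (fun n => ae_of_all _ fun ω => ?_) ?_
  · exact ((measurable_from_nat (f := fun j => (1 - e n) ^ j)).comp
      (h.measurable_process L N n)).aestronglyMeasurable
  · rw [Real.norm_of_nonneg (pow_nonneg (hrange n).1 _)]
    exact pow_le_one₀ (hrange n).1 (hrange n).2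
  · filter_upwards [hW] with ω hω
    -- `Z_n e_n` is eventually the product of `Z_n / μ_n → W` and `μ_n e_n → lam`.
    refine tendsto_one_sub_pow_exp he0 ((hω.mul hμe).congr' ?_)
    filter_upwards [hμ.eventually_gt_atTop 0] with n hn
    field_simp

end IsBivGeomArray

end BisexualBranching

theorem theorem12 {Ω : Type*} [MeasurableSpace Ω] (P : Measure Ω) [IsProbabilityMeasure P]
    (p : ℕ → BisexualBranching.BernoulliPair) (ξ η : ℕ → ℕ → Ω → ℕ)
    (hξη : BisexualBranching.IsBivGeomArray P p ξ η)
    (N : ℕ) (hN : 0 < N)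
    (Z : ℕ → Ω → ℕ)
    (hZ : Z = BisexualBranching.process BisexualBranching.promiscuous N ξ η)
    (μ : ℕ → ℝ)
    (hμ : μ = BisexualBranching.meanGrowth P BisexualBranching.promiscuous ξ η)
    (hμ_top : Tendsto μ atTop atTop)
    (a b c : ℝ) (ha : 0 ≤ a) (hb : 0 ≤ b) (hc : 0 ≤ c)
    (hp11 : ∀ᶠ n in atTop, 0 < (p n).p11)
    (hlim_c : Tendsto (fun n => (p n).p11 * Real.log (μ n)) atTop (𝓝 (2 * c)))
    (hlim_a : Tendsto (fun n => (p n).p10 / (p n).p11 * Real.log (μ n)) atTop (𝓝 a))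
    (hlim_b : Tendsto (fun n => (p n).p01 / (p n).p11 * Real.log (μ n)) atTop (𝓝 b))
    (hprod : ∃ q : ℝ, q ≠ 0 ∧
      Tendsto (fun n => ∏ j ∈ Finset.Icc 1 n, (p j).pPlus0 * (p j).p0Plus) atTop (𝓝 q))
    (hsum : Summable fun n => (p n).pPlus1) :
    ∃ W : Ω → ℝ, Measurable W ∧ (∀ ω, 0 ≤ W ω) ∧ Integrable W P ∧ 0 < P {ω | 0 < W ω} ∧
      (∀ᵐ ω ∂P, Tendsto (fun n => (Z n ω : ℝ) / μ n) atTop (𝓝 (W ω))) ∧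
      ∀ x y : ℝ,
        Tendsto
          (fun n => P.real {ω |
            (p n).p11 * (BisexualBranching.offspringMax Z ξ n ω : ℝ) - Real.log (μ n) ≤ x ∧
            (p n).p11 * (BisexualBranching.offspringMax Z η n ω : ℝ) - Real.log (μ n) ≤ y})
          atTop
          (𝓝 (∫ z in Set.Ici (0 : ℝ),
            BisexualBranching.limitG a b c x y ^ z ∂(P.map W))) := by
  subst hZ
  subst hμ
  have hs : BisexualBranching.LogScaling p (fun n => Real.log
      (BisexualBranching.meanGrowth P BisexualBranching.promiscuous ξ η n)) a b c :=
    ⟨Real.tendsto_log_atTop.comp hμ_top, hp11, hlim_c, hlim_a, hlim_b⟩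
  obtain ⟨W, hWm, hW0, hWi, hWpos, hWt⟩ := hξη.exists_limit hs hμ_top hsum hN
  exact ⟨W, hWm, hW0, hWi, hWpos, hWt, fun x y =>
    hξη.tendsto_measureReal_offspringMax_le hμ_top hs _ N hWm hW0 hWt x y⟩
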